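/- Conventions. Cubes in $\mathbb R^n$ ($n\ge 1$) are the sets $Q=a+\ell[0,1]^n$ with $a\in\mathbb R^n$, $\ell>0$; $|Q|$ is Lebesgue measure, $f_Q=\frac1{|Q|}\int_Q f$, and $p'=\frac p{p-1}$ for $1<p<\infty$. A weight is a non-negative locally integrable function $w$ on $\mathbb R^n$, and $w(Q)=\int_Q w$. Let $Mg(x)=\sup_{R\ni x}\frac1{|R|}\int_R|g|$ (supremum over all cubes $R$ containing $x$), and put $$[w]_{A_1}=\operatorname*{ess\,sup}_{x\in\mathbb R^n}\frac{Mw(x)}{w(x)},\qquad [w]_{A_p}=\sup_Q\Big(\frac1{|Q|}\int_Q w\Big)\Big(\frac1{|Q|}\int_Q w^{1-p'}\Big)^{p-1}\ (1<p<\infty),\qquad [w]_{A_\infty}=\sup_Q\frac{1}{w(Q)}\int_Q M(w\mathbf 1_Q).$$ For $1\le p<\infty$, $w\in A_p$ means that $w$ is a weight with $[w]_{A_p}<\infty$. A locally integrable function $f:\mathbb R^n\to\mathbb R$ belongs to $\mathrm{BMO}_{w,1}$ if $$\|f\|_{\mathrm{BMO}_{w,1}}=\sup_Q\frac1{w(Q)}\int_Q|f-f_Q|<\infty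 .$$ In these suprema the conventions of $[0,\infty]$ apply: $0\cdot\infty=0/0=0$ and $a/0=\infty$ for $a>0$. For a measure $\mu$, $\|g\|_{\exp L(\mu)}=\inf\{s>0:\int(e^{|g|/s}-1)\,d\mu\le 1\}$, and $\exp L\big(Q,\frac{w\,dx}{w(Q)}\big)$ is the case in which $\mu$ is the measure $\frac{w\,dx}{w(Q)}$ restricted to $Q$. Statement. For every $n\ge1$ there is a constant $c_n>0$, depending only on $n$, such that for every $w$ and every $f\in\mathrm{BMO}_{w,1}$ the following hold. (1) If $w\in A_1$, then for every $q>1$ and every cube $Q$, $$\left(\frac1{w(Q)}\int_Q\left|\frac{f(x)-f_Q}{w(x)}\right|^q w(x)\,dx\right)^{1/q}\le c_n\,q\,[w]_{A_1}^{1/q'}\,[w]_{A_\infty}^{1/q}\,\|f\|_{\mathrm{BMO}_{w,1}},$$ and for every cube $Q$, $$\left\|\frac{f-f_Q}{w}\right\|_{\exp L\left(Q,\frac{w(x)dx}{w(Q)}\right)}\le c_n\,[w]_{A_1}\,\|f\|_{\mathrm{BMO}_{w,1}}.$$ (2) If $w\in A_p$ with $1<p<\infty$, then for every cube $Q$, $$\left(\frac1{w(Q)}\int_Q\left|\frac{f(x)-f_Q}{w(x)}\right|^{p'}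 w(x)\,dx\right)^{1/p'}\le c_n\,p'\,[w]_{A_p}^{1/p}\,[w]_{A_\infty}^{1/p'}\,\|f\|_{\mathrm{BMO}_{w,1}}.$$ -/

import Mathlib

open MeasureTheory
open scoped ENNReal

noncomputable section

/-- The cubes of `ℝⁿ`: sets `a + ℓ [0,1]ⁿ` with `ℓ > 0` (sides parallel to the axes). -/
def IsCube {n : ℕ} (Q : Set (Fin n → ℝ)) : Prop :=
  ∃ (a : Fin n → ℝ) (ℓ : ℝ), 0 < ℓ ∧ Q = Set.Icc a (fun i => a i + ℓ)

/-- A weight: a non-negative locally integrable function on `ℝⁿ`. -/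
structure IsWeight {n : ℕ} (w : (Fin n → ℝ) → ℝ) : Prop where
  nonneg : ∀ x, 0 ≤ w x
  locallyIntegrable : LocallyIntegrable w volume

/-- The measure `w dx`; thus `weightMeasure w Q` is `w(Q) = ∫_Q w`. -/
def weightMeasure {n : ℕ} (w : (Fin n → ℝ) → ℝ) : Measure (Fin n → ℝ) :=
  volume.withDensity (fun x => ENNReal.ofReal (w x))

/-- The measure `w dx / w(Q)` on `Q`. -/
def normalizedWeightMeasure {n : ℕ} (w : (Fin n → ℝ) → ℝ) (Q : Set (Fin n → ℝ)) :
    Measure (Fin n → ℝ) :=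
  (weightMeasure w Q)⁻¹ • (weightMeasure w).restrict Q

/-- The (uncentred) Hardy-Littlewood maximal function `M g`, over all cubes containing `x`. -/
def hlMaximal {n : ℕ} (g : (Fin n → ℝ) → ℝ) (x : Fin n → ℝ) : ℝ≥0∞ :=
  ⨆ (Q : Set (Fin n → ℝ)) (_ : IsCube Q) (_ : x ∈ Q), ⨍⁻ y in Q, ‖g y‖ₑ ∂volume

/-- `[w]_{A_1} = ess sup Mw / w`. -/
def a1Const {n : ℕ} (w : (Fin n → ℝ) → ℝ) : ℝ≥0∞ :=
  essSup (fun x => hlMaximal w x / ENNReal.ofReal (w x)) volume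

/-- `[w]_{A_p} = sup_Q (⨍_Q w) (⨍_Q w^{1-p'})^{p-1}`, for `1 < p < ∞`.
The powers are taken in `[0,∞]`, so that `w^{1-p'} = ∞` where `w = 0`. -/
def apConst {n : ℕ} (p : ℝ) (w : (Fin n → ℝ) → ℝ) : ℝ≥0∞ :=
  ⨆ (Q : Set (Fin n → ℝ)) (_ : IsCube Q),
    (⨍⁻ x in Q, ENNReal.ofReal (w x) ∂volume) *
      (⨍⁻ x in Q, ENNReal.ofReal (w x) ^ (1 - p.conjExponent) ∂volume) ^ (p - 1)

/-- `[w]_{A_∞} = sup_Q (1 / w(Q)) ∫_Q M(w 1_Q)`. -/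
def aInftyConst {n : ℕ} (w : (Fin n → ℝ) → ℝ) : ℝ≥0∞ :=
  ⨆ (Q : Set (Fin n → ℝ)) (_ : IsCube Q),
    (∫⁻ x in Q, hlMaximal (Q.indicator w) x) / weightMeasure w Q

/-- The class `A_1`. -/
def MemA1 {n : ℕ} (w : (Fin n → ℝ) → ℝ) : Prop :=
  IsWeight w ∧ a1Const w < ∞

/-- The class `A_p`, for `1 < p < ∞`. -/
def MemAp {n : ℕ} (p : ℝ) (w : (Fin n → ℝ) → ℝ) : Prop :=
  IsWeight w ∧ apConst p w < ∞

/-- `‖f‖_{BMO_{w,1}} = sup_Q (1 / w(Q)) ∫_Q |f - f_Q|`. -/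
def bmoNorm {n : ℕ} (w f : (Fin n → ℝ) → ℝ) : ℝ≥0∞ :=
  ⨆ (Q : Set (Fin n → ℝ)) (_ : IsCube Q),
    (∫⁻ x in Q, ‖f x - ⨍ y in Q, f y‖ₑ) / weightMeasure w Q

/-- The class `BMO_{w,1}`. -/
def MemBMO {n : ℕ} (w f : (Fin n → ℝ) → ℝ) : Prop :=
  LocallyIntegrable f volume ∧ bmoNorm w f < ∞

/-- The Luxemburg norm of `g` in `exp L(μ)`:
the infimum of the `s > 0` with `∫ (exp(|g|/s) - 1) dμ ≤ 1` (it is `∞` if there is none). -/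
def expLNorm {α : Type*} [MeasurableSpace α] (g : α → ℝ) (μ : Measure α) : ℝ≥0∞ :=
  ⨅ (s : ℝ) (_ : 0 < s)
    (_ : ∫⁻ x, ENNReal.ofReal (Real.exp (|g x| / s) - 1) ∂μ ≤ 1), ENNReal.ofReal s

end

/-! Fix a cube `Q` and its dyadic subcells. Starting from `Q`, select inside each selected cell `P`
the maximal subcells on which `|f - f_P|` has average above four times its average over `P`. By
Chebyshev the selected cells strictly inside `P` fill at most a quarter of it, and telescoping the
means, with Lebesgue differentiation, gives `|f - f_Q| ≤ 4 · 2ⁿ ∑ osc(P) 1_P` almost everywhere on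
`Q`. Since `osc(P) ≤ ‖f‖ w(P)/|P|`, everything reduces to the sparse operator `∑ w_P 1_P`
(`ae_enorm_sub_le_tsum_weight`).

Let `q = p'` and let `h ≥ 0` be a test function in `L^p(w)`. The form `∑ w(P) h_P` is split at a
level `T` (`IsSparse.bilinear_le`). Where `h_P ≤ T`, the packing bound `∑ w(P) ≤ 2 ∫_Q M(w 1_Q)`
brings in `[w]_{A_∞}`. Where `h_P` is comparable to `t = T 2^j`, half of the mass of `h` on `P` sits
on the part of `P` outside the smaller members; these parts are disjoint, so Hölder and the `A_p`
condition give `t^p ∑ w(P) ≤ 2^p [w]_{A_p} ∫ h^p w`. Summing over `j` costs a factor comparable to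
`q`, and optimizing `T` gives the mixed bound `[w]_{A_p}^{1/p} [w]_{A_∞}^{1/q}`. Taking `h =
g^{q-1}`, with `g` a truncation of `|f - f_Q|/w`, yields (2).

For (1), `[w]_{A_p} ≤ [w]_{A_1}` for every `p > 1`, so (2) applies with `p = q'`. Linear growth in
`q` of the resulting norms is exponential integrability. -/

/-! ### Dyadic cells of a cube -/

noncomputable section DyadicCells

variable {n : ℕ} (a : Fin n → ℝ) (ℓ : ℝ)

/-- The index of the dyadic cell of level `k` (side `ℓ / 2 ^ k`, grid based at `a`) containing `x`. -/
def cellIndex (k : ℕ) (x : Fin n → ℝ) : Fin n → ℤ := fun i => ⌊2 ^ k * ((x i - a i) / ℓ)⌋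

/-- The half-open dyadic cell of level `k` containing `x`. -/
def cell (k : ℕ) (x : Fin n → ℝ) : Set (Fin n → ℝ) := {y | cellIndex a ℓ k y = cellIndex a ℓ k x}

/-- The lower corner of the cell of level `k` containing `x`. -/
def cellCorner (k : ℕ) (x : Fin n → ℝ) : Fin n → ℝ :=
  fun i => a i + ℓ / 2 ^ k * (cellIndex a ℓ k x i : ℝ)

/-- The closure of the cell of level `k` containing `x`. -/
def closedCell (k : ℕ) (x : Fin n → ℝ) : Set (Fin n → ℝ) :=
  Set.Icc (cellCorner a ℓ k x) (fun i => cellCorner a ℓ k x i + ℓ / 2 ^ k)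

/-- A set is saturated at level `k` if it is a union of cells of level `k`. -/
def Saturated (k : ℕ) (B : Set (Fin n → ℝ)) : Prop := ∀ x ∈ B, cell a ℓ k x ⊆ B

variable {a ℓ}

theorem mem_cell_self (k : ℕ) (x : Fin n → ℝ) : x ∈ cell a ℓ k x := rfl

theorem cell_eq_of_mem {k : ℕ} {x y : Fin n → ℝ} (h : y ∈ cell a ℓ k x) :
    cell a ℓ k y = cell a ℓ k x := by
  have h' : cellIndex a ℓ k y = cellIndex a ℓ k x := h
  simp only [cell, h']

/-- `⌊u⌋` is the integer quotient of `⌊2 * u⌋` by `2`; this is the nesting of consecutive dyadic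
grids. -/
theorem floor_two_mul_eq {s t : ℝ} (h : ⌊2 * s⌋ = ⌊2 * t⌋) : ⌊s⌋ = ⌊t⌋ := by
  have key : ∀ u : ℝ, ⌊u⌋ = ⌊2 * u⌋ / 2 := by
    intro u
    have h1 := Int.floor_le (2 * u)
    have h2 := Int.lt_floor_add_one (2 * u)
    rw [Int.floor_eq_iff]
    have h3 : 2 * (⌊2 * u⌋ / 2) ≤ ⌊2 * u⌋ := by omega
    have h4 : ⌊2 * u⌋ + 1 ≤ 2 * (⌊2 * u⌋ / 2) + 2 := by omega
    have h3' : (2 : ℝ) * ((⌊2 * u⌋ / 2 : ℤ) : ℝ) ≤ (⌊2 * u⌋ : ℝ) := by exact_mod_cast h3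
    have h4' : (⌊2 * u⌋ : ℝ) + 1 ≤ 2 * ((⌊2 * u⌋ / 2 : ℤ) : ℝ) + 2 := by exact_mod_cast h4
    constructor <;> linarith
  rw [key s, key t, h]

theorem cell_succ_subset (k : ℕ) (x : Fin n → ℝ) : cell a ℓ (k + 1) x ⊆ cell a ℓ k x := by
  intro y hy
  have hy' : cellIndex a ℓ (k + 1) y = cellIndex a ℓ (k + 1) x := hy
  funext i
  have := congrFun hy' i
  simp only [cellIndex, pow_succ, mul_comm _ (2 : ℝ), mul_assoc] at this
  exact floor_two_mul_eq this

theorem cell_subset_of_le {k k' : ℕ} (h : k ≤ k') (x : Fin n → ℝ) :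
    cell a ℓ k' x ⊆ cell a ℓ k x := by
  induction h with
  | refl => exact subset_rfl
  | step _ ih => exact (cell_succ_subset _ x).trans ih

theorem saturated_cell {k k' : ℕ} (h : k ≤ k') (x : Fin n → ℝ) :
    Saturated a ℓ k' (cell a ℓ k x) := fun y hy =>
  (cell_subset_of_le h y).trans (cell_eq_of_mem hy).le

theorem Saturated.of_le {k k' : ℕ} (h : k ≤ k') {B : Set (Fin n → ℝ)} (hB : Saturated a ℓ k B) :
    Saturated a ℓ k' B := fun x hx => (cell_subset_of_le h x).trans (hB x hx)

theorem Saturated.mem_iff {k : ℕ} {B : Set (Fin n → ℝ)} (hB : Saturated a ℓ k B)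
    {x y : Fin n → ℝ} (h : y ∈ cell a ℓ k x) : y ∈ B ↔ x ∈ B :=
  ⟨fun hy => hB y hy (by rw [cell_eq_of_mem h]; rfl), fun hx => hB x hx h⟩

theorem measurable_cellIndex (k : ℕ) : Measurable (cellIndex a ℓ k) := by
  unfold cellIndex
  fun_prop

theorem measurable_of_cell_const {β : Type*} [MeasurableSpace β] {k : ℕ} {g : (Fin n → ℝ) → β}
    (hg : ∀ x, ∀ y ∈ cell a ℓ k x, g y = g x) : Measurable g := by
  have : g = (Function.extend (cellIndex a ℓ k) g fun _ => g 0) ∘ cellIndex a ℓ k := by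
    funext x
    have hf : Function.FactorsThrough g (cellIndex a ℓ k) := fun x y hxy => hg y x hxy
    exact (hf.extend_apply _ x).symm
  rw [this]
  exact (measurable_from_top (f := Function.extend (cellIndex a ℓ k) g fun _ => g 0)).comp
    ((measurable_cellIndex k).mono le_rfl (by
      intro s _
      exact MeasurableSet.of_discrete))

theorem Saturated.measurableSet {k : ℕ} {B : Set (Fin n → ℝ)} (hB : Saturated a ℓ k B) :
    MeasurableSet B := by
  have : B = cellIndex a ℓ k ⁻¹' (cellIndex a ℓ k '' B) := by
    refine (Set.subset_preimage_image _ _).antisymm ?_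
    rintro y ⟨x, hx, hxy⟩
    exact hB x hx hxy.symm
  rw [this]
  exact measurable_cellIndex k MeasurableSet.of_discrete

theorem measurableSet_cell (k : ℕ) (x : Fin n → ℝ) : MeasurableSet (cell a ℓ k x) :=
  (saturated_cell le_rfl x).measurableSet

theorem setLIntegral_le_of_cell {k : ℕ} {B : Set (Fin n → ℝ)} (hB : Saturated a ℓ k B)
    {φ ψ : (Fin n → ℝ) → ℝ≥0∞}
    (h : ∀ x ∈ B, ∫⁻ y in cell a ℓ k x, φ y ≤ ∫⁻ y in cell a ℓ k x, ψ y) :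
    ∫⁻ y in B, φ y ≤ ∫⁻ y in B, ψ y := by
  have hU : B = ⋃ v : Fin n → ℤ, B ∩ cellIndex a ℓ k ⁻¹' {v} := by
    ext x; simp
  have hm : ∀ v : Fin n → ℤ, MeasurableSet (B ∩ cellIndex a ℓ k ⁻¹' {v}) := fun v =>
    hB.measurableSet.inter (measurable_cellIndex k (measurableSet_singleton v))
  have hd : Pairwise (Function.onFun Disjoint fun v : Fin n → ℤ =>
      B ∩ cellIndex a ℓ k ⁻¹' {v}) := by
    intro v w hvw
    refine Set.disjoint_left.2 ?_
    rintro x ⟨_, hx⟩ ⟨_, hx'⟩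
    exact hvw (by rw [← (hx : _ = v), ← (hx' : _ = w)])
  rw [hU, lintegral_iUnion hm hd, lintegral_iUnion hm hd]
  refine ENNReal.tsum_le_tsum fun v => ?_
  rcases Set.eq_empty_or_nonempty (B ∩ cellIndex a ℓ k ⁻¹' {v}) with he | ⟨x, hx, hxv⟩
  · simp [he]
  · have : B ∩ cellIndex a ℓ k ⁻¹' {v} = cell a ℓ k x := by
      have hxv' : cellIndex a ℓ k x = v := hxv
      ext y
      constructor
      · rintro ⟨_, hy⟩
        exact (hy : _ = v).trans hxv'.symm
      · intro hy
        exact ⟨hB x hx hy, (hy : _ = _).trans hxv'⟩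
    rw [this]
    exact h x hx

theorem setLIntegral_eq_of_cell {k : ℕ} {B : Set (Fin n → ℝ)} (hB : Saturated a ℓ k B)
    {φ ψ : (Fin n → ℝ) → ℝ≥0∞}
    (h : ∀ x ∈ B, ∫⁻ y in cell a ℓ k x, φ y = ∫⁻ y in cell a ℓ k x, ψ y) :
    ∫⁻ y in B, φ y = ∫⁻ y in B, ψ y :=
  (setLIntegral_le_of_cell hB fun x hx => (h x hx).le).antisymm
    (setLIntegral_le_of_cell hB fun x hx => (h x hx).ge)

/-- A local inequality on the first cells of a family met inside `P` integrates to the union. -/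
theorem setLIntegral_le_of_first {k : ℕ} {P : Set (Fin n → ℝ)} (hP : Saturated a ℓ k P)
    {V : ℕ → Set (Fin n → ℝ)} (hV : ∀ i, Saturated a ℓ i (V i)) {φ ψ : (Fin n → ℝ) → ℝ≥0∞}
    (H : ∀ i, k < i → ∀ y ∈ P, y ∈ V i → (∀ j, k < j → j < i → y ∉ V j) →
      ∫⁻ z in cell a ℓ i y, φ z ≤ ∫⁻ z in cell a ℓ i y, ψ z) :
    ∫⁻ y in {y | y ∈ P ∧ ∃ i > k, y ∈ V i}, φ y ≤ ∫⁻ y in {y | y ∈ P ∧ ∃ i > k, y ∈ V i}, ψ y := by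
  classical
  -- `F i` collects the points whose first member beyond level `k` has level `i`. It is a union of
  -- cells of level `i`, because the conditions at levels `j < i` are constant on coarser cells.
  set F : ℕ → Set (Fin n → ℝ) :=
    fun i => {y | y ∈ P ∧ k < i ∧ y ∈ V i ∧ ∀ j, k < j → j < i → y ∉ V j} with hF
  have hU : {y | y ∈ P ∧ ∃ i > k, y ∈ V i} = ⋃ i, F i := by
    ext y
    simp only [hF, Set.mem_ofPred_eq, Set.mem_iUnion]
    constructor
    · rintro ⟨hy, hex⟩
      refine ⟨Nat.find hex, hy, (Nat.find_spec hex).1, (Nat.find_spec hex).2, ?_⟩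
      intro j hkj hj hyj
      exact Nat.find_min hex hj ⟨hkj, hyj⟩
    · rintro ⟨i, hy, hi, hyi, _⟩
      exact ⟨hy, i, hi, hyi⟩
  have hs : ∀ i, Saturated a ℓ i (F i) := by
    rintro i x ⟨hx, hki, hxi, hj⟩ y hy
    refine ⟨((hP.of_le hki.le).mem_iff hy).2 hx, hki, ((hV i).mem_iff hy).2 hxi, ?_⟩
    intro j hkj hji hyj
    exact hj j hkj hji ((((hV j).of_le hji.le).mem_iff hy).1 hyj)
  have hd : Pairwise (Function.onFun Disjoint F) := by
    intro i j hij
    refine Set.disjoint_left.2 ?_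
    rintro x ⟨_, hi, hxi, hi'⟩ ⟨_, hj, hxj, hj'⟩
    rcases lt_or_gt_of_ne hij with h | h
    · exact hj' i hi h hxi
    · exact hi' j hj h hxj
  rw [hU, lintegral_iUnion (fun i => (hs i).measurableSet) hd,
    lintegral_iUnion (fun i => (hs i).measurableSet) hd]
  refine ENNReal.tsum_le_tsum fun i => setLIntegral_le_of_cell (hs i) ?_
  rintro x ⟨hx, hki, hxi, hj⟩
  exact H i hki x hx hxi hj

theorem closedCell_zero_base : closedCell a ℓ 0 a = Set.Icc a fun i => a i + ℓ := by
  have : cellCorner a ℓ 0 a = a := by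
    funext i; simp [cellCorner, cellIndex]
  simp [closedCell, this]

section Geometry

variable (hℓ : 0 < ℓ)
include hℓ

theorem cell_eq_pi (k : ℕ) (x : Fin n → ℝ) :
    cell a ℓ k x = Set.univ.pi fun i =>
      Set.Ico (cellCorner a ℓ k x i) (cellCorner a ℓ k x i + ℓ / 2 ^ k) := by
  ext y
  have h2 : (0 : ℝ) < 2 ^ k := by positivity
  have hy : y ∈ cell a ℓ k x ↔ ∀ i, cellIndex a ℓ k y i = cellIndex a ℓ k x i := funext_iff
  rw [hy, Set.mem_univ_pi]
  refine forall_congr' fun i => ?_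
  generalize hz : cellIndex a ℓ k x i = z
  simp only [cellCorner, hz, Set.mem_Ico]
  rw [cellIndex, Int.floor_eq_iff]
  have e1 : 2 ^ k * ((y i - a i) / ℓ) = (y i - a i) / (ℓ / 2 ^ k) := by field_simp
  have hs : 0 < ℓ / 2 ^ k := by positivity
  rw [e1, le_div_iff₀ hs, div_lt_iff₀ hs]
  constructor
  · rintro ⟨h3, h4⟩; constructor <;> linarith
  · rintro ⟨h3, h4⟩; constructor <;> linarith

theorem isCube_closedCell (k : ℕ) (x : Fin n → ℝ) : IsCube (closedCell a ℓ k x) :=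
  ⟨cellCorner a ℓ k x, ℓ / 2 ^ k, by positivity, rfl⟩

/-- Half-open cells partition space, while the suprema in the constants run over closed cubes; the
two differ by a null set, so their averages agree. -/
theorem cell_ae_eq (k : ℕ) (x : Fin n → ℝ) : cell a ℓ k x =ᵐ[volume] closedCell a ℓ k x := by
  rw [cell_eq_pi hℓ]
  exact Measure.univ_pi_Ico_ae_eq_Icc

theorem cell_subset_closedCell (k : ℕ) (x : Fin n → ℝ) : cell a ℓ k x ⊆ closedCell a ℓ k x := by
  rw [cell_eq_pi hℓ]
  intro y hy
  rw [Set.mem_univ_pi] at hy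
  exact ⟨fun i => (hy i).1, fun i => (hy i).2.le⟩

theorem volume_cell (k : ℕ) (x : Fin n → ℝ) :
    volume (cell a ℓ k x) = ENNReal.ofReal (ℓ / 2 ^ k) ^ n := by
  rw [measure_congr (cell_ae_eq hℓ k x), closedCell, Real.volume_Icc_pi]
  simp

theorem volume_cell_ne_zero (k : ℕ) (x : Fin n → ℝ) : volume (cell a ℓ k x) ≠ 0 := by
  rw [volume_cell hℓ]
  have : 0 < ℓ / 2 ^ k := by positivity
  simp [this]

theorem volume_cell_ne_top (k : ℕ) (x : Fin n → ℝ) : volume (cell a ℓ k x) ≠ ∞ := by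
  rw [volume_cell hℓ]
  exact ENNReal.pow_ne_top ENNReal.ofReal_ne_top

theorem volume_cell_succ (k : ℕ) (x : Fin n → ℝ) :
    volume (cell a ℓ k x) = 2 ^ n * volume (cell a ℓ (k + 1) x) := by
  rw [volume_cell hℓ, volume_cell hℓ, ← mul_pow, ← ENNReal.ofReal_ofNat 2,
    ← ENNReal.ofReal_mul (by norm_num)]
  congr 2
  rw [pow_succ]; field_simp

theorem setLAverage_cell_mul_volume (g : (Fin n → ℝ) → ℝ≥0∞) (k : ℕ) (x : Fin n → ℝ) :
    (⨍⁻ y in cell a ℓ k x, g y ∂volume) * volume (cell a ℓ k x) = ∫⁻ y in cell a ℓ k x, g y := by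
  rw [setLAverage_eq, ENNReal.div_mul_cancel (volume_cell_ne_zero hℓ k x)
    (volume_cell_ne_top hℓ k x)]

theorem setLAverage_cell_eq_closedCell (g : (Fin n → ℝ) → ℝ≥0∞) (k : ℕ) (x : Fin n → ℝ) :
    ⨍⁻ y in cell a ℓ k x, g y ∂volume = ⨍⁻ y in closedCell a ℓ k x, g y ∂volume := by
  rw [Measure.restrict_congr_set (cell_ae_eq hℓ k x)]

theorem setLAverage_cell_succ_le (g : (Fin n → ℝ) → ℝ≥0∞) (k : ℕ) (x : Fin n → ℝ) :
    ⨍⁻ y in cell a ℓ (k + 1) x, g y ∂volume ≤ 2 ^ n * ⨍⁻ y in cell a ℓ k x, g y ∂volume := by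
  rw [setLAverage_eq, setLAverage_eq]
  refine ENNReal.div_le_of_le_mul ?_
  have h := volume_cell_succ (a := a) hℓ k x
  rw [mul_assoc, mul_comm, mul_assoc]
  calc ∫⁻ y in cell a ℓ (k + 1) x, g y ≤ ∫⁻ y in cell a ℓ k x, g y :=
        lintegral_mono_set (cell_succ_subset k x)
    _ = (∫⁻ y in cell a ℓ k x, g y) / volume (cell a ℓ k x) * volume (cell a ℓ k x) :=
        (ENNReal.div_mul_cancel (volume_cell_ne_zero hℓ k x) (volume_cell_ne_top hℓ k x)).symm
    _ = _ := by rw [h]; ring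

/-- Averages over the dyadic cells converge almost everywhere. -/
theorem ae_tendsto_average_cell {f : (Fin n → ℝ) → ℝ} (hf : LocallyIntegrable f volume) :
    ∀ᵐ x, Filter.Tendsto (fun k => ⨍ y in cell a ℓ k x, f y) Filter.atTop (nhds (f x)) := by
  filter_upwards [IsUnifLocDoublingMeasure.ae_tendsto_average volume hf 1] with x hx
  have h0 : Filter.Tendsto (fun k : ℕ => ℓ / 2 ^ k / 2) Filter.atTop (nhdsWithin 0 (Set.Ioi 0)) := by
    refine tendsto_nhdsWithin_iff.2 ⟨?_, Filter.Eventually.of_forall fun k => ?_⟩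
    · have := (tendsto_pow_atTop_nhds_zero_of_lt_one (r := (1 / 2 : ℝ)) (by norm_num)
        (by norm_num)).const_mul (ℓ / 2)
      rw [mul_zero] at this
      refine this.congr fun k => ?_
      rw [one_div, inv_pow]; field_simp
    · have : 0 < ℓ / 2 ^ k / 2 := by positivity
      exact this
  -- In the sup norm a closed cell is a ball whose radius is half its side. It contains `x` without
  -- being centred there, so the differentiation theorem for uncentred balls applies.
  have hball : ∀ k : ℕ, Metric.closedBall (fun i => cellCorner a ℓ k x i + ℓ / 2 ^ k / 2)
      (ℓ / 2 ^ k / 2) = closedCell a ℓ k x := by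
    intro k
    have hpos : 0 ≤ ℓ / 2 ^ k / 2 := by positivity
    rw [closedBall_pi _ hpos, closedCell, ← Set.pi_univ_Icc]
    refine congrArg (Set.pi Set.univ) (funext fun i => ?_)
    rw [Real.closedBall_eq_Icc]
    congr 1 <;> ring
  have := hx (fun (k : ℕ) => (fun i => cellCorner a ℓ k x i + ℓ / 2 ^ k / 2 : Fin n → ℝ))
    (fun k => ℓ / 2 ^ k / 2) h0 (Filter.Eventually.of_forall fun k => by
      rw [one_mul, hball]
      exact cell_subset_closedCell hℓ k x (mem_cell_self k x))
  refine this.congr fun k => ?_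
  rw [hball]
  exact (setAverage_congr (cell_ae_eq hℓ k x)).symm

end Geometry

end DyadicCells

/-! ### Sums over sparse families of cells -/

noncomputable section SparseSums

variable {n : ℕ} (a : Fin n → ℝ) (ℓ : ℝ)

/-- The average of `g` over the cell of level `k` containing `x`. -/
def cellAverage (k : ℕ) (g : (Fin n → ℝ) → ℝ≥0∞) (x : Fin n → ℝ) : ℝ≥0∞ :=
  ⨍⁻ y in cell a ℓ k x, g y ∂volume

/-- A family of cells (`U k` is the union of those of level `k`) is sparse if the members strictly
inside any given member fill at most a quarter of it. -/
structure IsSparse (U : ℕ → Set (Fin n → ℝ)) : Prop where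
  saturated : ∀ k, Saturated a ℓ k (U k)
  sparse : ∀ k, ∀ x ∈ U k,
    4 * volume {y | y ∈ cell a ℓ k x ∧ ∃ i > k, y ∈ U i} ≤ volume (cell a ℓ k x)

/-- The points of `U k` that lie in no member of a higher level. -/
def lastPart (U : ℕ → Set (Fin n → ℝ)) (k : ℕ) : Set (Fin n → ℝ) :=
  {x | x ∈ U k ∧ ∀ i > k, x ∉ U i}

variable {a ℓ} {U V : ℕ → Set (Fin n → ℝ)}

theorem cellAverage_eq_of_mem {k : ℕ} {x y : Fin n → ℝ} (h : y ∈ cell a ℓ k x)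
    (g : (Fin n → ℝ) → ℝ≥0∞) : cellAverage a ℓ k g y = cellAverage a ℓ k g x := by
  simp only [cellAverage, cell_eq_of_mem h]

theorem measurable_cellAverage (k : ℕ) (g : (Fin n → ℝ) → ℝ≥0∞) :
    Measurable (cellAverage a ℓ k g) :=
  measurable_of_cell_const fun _ _ h => cellAverage_eq_of_mem h g

theorem setLIntegral_cell_cellAverage_mul (k : ℕ) (g : (Fin n → ℝ) → ℝ≥0∞)
    {h : (Fin n → ℝ) → ℝ≥0∞} (hh : AEMeasurable h volume) (x : Fin n → ℝ) :
    ∫⁻ y in cell a ℓ k x, cellAverage a ℓ k g y * h y =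
      cellAverage a ℓ k g x * ∫⁻ y in cell a ℓ k x, h y := by
  rw [← lintegral_const_mul'' _ hh.restrict]
  exact setLIntegral_congr_fun (measurableSet_cell k x) fun y hy => by
    simp only [cellAverage_eq_of_mem hy]

theorem setLIntegral_cell_cellAverage (k : ℕ) (g : (Fin n → ℝ) → ℝ≥0∞) (x : Fin n → ℝ) :
    ∫⁻ y in cell a ℓ k x, cellAverage a ℓ k g y =
      cellAverage a ℓ k g x * volume (cell a ℓ k x) := by
  simpa using setLIntegral_cell_cellAverage_mul (a := a) (ℓ := ℓ) k g
    (h := fun _ => 1) aemeasurable_const x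

theorem IsSparse.mono (hU : IsSparse a ℓ U) (hV : ∀ k, Saturated a ℓ k (V k))
    (h : ∀ k, V k ⊆ U k) : IsSparse a ℓ V where
  saturated := hV
  sparse k x hx := by
    refine le_trans ?_ (hU.sparse k x (h k hx))
    refine mul_le_mul' le_rfl (measure_mono ?_)
    rintro y ⟨hy, i, hi, hyi⟩
    exact ⟨hy, i, hi, h i hyi⟩

theorem measurableSet_lastPart (hU : IsSparse a ℓ U) (k : ℕ) : MeasurableSet (lastPart U k) := by
  have : lastPart U k = U k \ ⋃ i, ⋃ (_ : k < i), U i := by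
    ext x; simp [lastPart]
  rw [this]
  exact (hU.saturated k).measurableSet.diff
    (MeasurableSet.iUnion fun i => MeasurableSet.iUnion fun _ => (hU.saturated i).measurableSet)

theorem pairwise_disjoint_lastPart : Pairwise (Function.onFun Disjoint (lastPart U)) := by
  intro i j hij
  refine Set.disjoint_left.2 ?_
  rintro x ⟨hi, hi'⟩ ⟨hj, hj'⟩
  rcases lt_or_gt_of_ne hij with h | h
  · exact hi' j h hj
  · exact hj' i h hi

theorem cell_subset_union_lastPart (hU : IsSparse a ℓ U) {k : ℕ} {x : Fin n → ℝ} (hx : x ∈ U k) :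
    cell a ℓ k x ⊆ {y | y ∈ cell a ℓ k x ∧ ∃ i > k, y ∈ U i} ∪ (cell a ℓ k x ∩ lastPart U k) := by
  intro y hy
  by_cases h : ∃ i > k, y ∈ U i
  · exact Or.inl ⟨hy, h⟩
  · refine Or.inr ⟨hy, hU.saturated k x hx hy, fun i hi hyi => h ⟨i, hi, hyi⟩⟩

/-- Local bounds by integrals over the disjoint last parts can be summed. -/
theorem tsum_setLIntegral_le_of_lastPart (hU : IsSparse a ℓ U) {P : Set (Fin n → ℝ)}
    (hP : ∀ k, U k ⊆ P) {φ : ℕ → (Fin n → ℝ) → ℝ≥0∞} {Φ : (Fin n → ℝ) → ℝ≥0∞}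
    (h : ∀ k, ∀ x ∈ U k, ∫⁻ y in cell a ℓ k x, φ k y ≤ ∫⁻ y in cell a ℓ k x ∩ lastPart U k, Φ y) :
    ∑' k, ∫⁻ y in U k, φ k y ≤ ∫⁻ y in P, Φ y := by
  have hm := measurableSet_lastPart hU
  calc ∑' k, ∫⁻ y in U k, φ k y ≤ ∑' k, ∫⁻ y in lastPart U k, Φ y := by
        refine ENNReal.tsum_le_tsum fun k => ?_
        have h1 : ∫⁻ y in U k, φ k y ≤ ∫⁻ y in U k, (lastPart U k).indicator Φ y := by
          refine setLIntegral_le_of_cell (hU.saturated k) fun x hx => ?_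
          rw [setLIntegral_indicator (hm k), Set.inter_comm]
          exact h k x hx
        refine h1.trans ?_
        rw [setLIntegral_indicator (hm k)]
        exact lintegral_mono_set Set.inter_subset_left
    _ = ∫⁻ y in ⋃ k, lastPart U k, Φ y := (lintegral_iUnion hm pairwise_disjoint_lastPart _).symm
    _ ≤ ∫⁻ y in P, Φ y :=
        lintegral_mono_set (Set.iUnion_subset fun k x hx => hP k hx.1)

variable (hℓ : 0 < ℓ)
include hℓ

theorem cellAverage_mul_volume (k : ℕ) (g : (Fin n → ℝ) → ℝ≥0∞) (x : Fin n → ℝ) :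
    cellAverage a ℓ k g x * volume (cell a ℓ k x) = ∫⁻ y in cell a ℓ k x, g y :=
  setLAverage_cell_mul_volume hℓ g k x

/-- At most a quarter of the cell is covered by later members, so at least three quarters remain;
half suffices. -/
theorem volume_cell_le_two_mul_lastPart (hU : IsSparse a ℓ U) {k : ℕ} {x : Fin n → ℝ}
    (hx : x ∈ U k) : volume (cell a ℓ k x) ≤ 2 * volume (cell a ℓ k x ∩ lastPart U k) := by
  have h1 := (measure_mono (μ := volume) (cell_subset_union_lastPart hU hx)).trans
    (measure_union_le _ _)
  have h2 := hU.sparse k x hx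
  have hv := volume_cell_ne_top (a := a) hℓ k x
  have hL : volume (cell a ℓ k x ∩ lastPart U k) ≠ ∞ :=
    ne_top_of_le_ne_top hv (measure_mono Set.inter_subset_left)
  have hT : volume {y | y ∈ cell a ℓ k x ∧ ∃ i > k, y ∈ U i} ≠ ∞ :=
    ne_top_of_le_ne_top hv (measure_mono fun y hy => hy.1)
  generalize volume (cell a ℓ k x) = v at *
  generalize volume (cell a ℓ k x ∩ lastPart U k) = l at *
  generalize volume {y | y ∈ cell a ℓ k x ∧ ∃ i > k, y ∈ U i} = t at *
  lift v to NNReal using hv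
  lift l to NNReal using hL
  lift t to NNReal using hT
  norm_cast at *
  have h1' : (v : ℝ) ≤ t + l := by exact_mod_cast h1
  have h2' : (4 : ℝ) * t ≤ v := by exact_mod_cast h2
  have : (v : ℝ) ≤ 2 * l := by linarith [l.coe_nonneg, v.coe_nonneg]
  exact_mod_cast this

/-- The Carleson packing bound for a sparse family. -/
theorem IsSparse.tsum_cellAverage_le (hU : IsSparse a ℓ U) {P : Set (Fin n → ℝ)}
    (hP : ∀ k, U k ⊆ P) {w Φ : (Fin n → ℝ) → ℝ≥0∞}
    (hΦ : ∀ k, ∀ x ∈ U k, cellAverage a ℓ k w x ≤ Φ x) :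
    ∑' k, ∫⁻ y in U k, cellAverage a ℓ k w y ≤ 2 * ∫⁻ y in P, Φ y := by
  rw [← lintegral_const_mul' _ _ ENNReal.ofNat_ne_top]
  refine tsum_setLIntegral_le_of_lastPart hU hP fun k x hx => ?_
  have hm := (measurableSet_cell (a := a) (ℓ := ℓ) k x).inter (measurableSet_lastPart hU k)
  rw [setLIntegral_cell_cellAverage]
  calc cellAverage a ℓ k w x * volume (cell a ℓ k x)
      ≤ cellAverage a ℓ k w x * (2 * volume (cell a ℓ k x ∩ lastPart U k)) := by
        gcongr; exact volume_cell_le_two_mul_lastPart hℓ hU hx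
    _ = ∫⁻ _ in cell a ℓ k x ∩ lastPart U k, 2 * cellAverage a ℓ k w x := by
        rw [setLIntegral_const]; ring
    _ ≤ _ := by
        refine setLIntegral_mono' hm fun y hy => ?_
        gcongr
        rw [← cellAverage_eq_of_mem hy.1]
        exact hΦ k y hy.2.1

/-- If the averages of `h` over the members of a sparse family are comparable to `t`, half of the
mass of `h` on each member lies on its last part. -/
theorem IsSparse.mul_volume_le_two_mul_lintegral (hU : IsSparse a ℓ U) {h : (Fin n → ℝ) → ℝ≥0∞}
    {t : ℝ≥0∞} (ht : t ≠ ∞) (hlow : ∀ k, ∀ x ∈ U k, t ≤ cellAverage a ℓ k h x)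
    (hup : ∀ k, ∀ x ∈ U k, cellAverage a ℓ k h x ≤ 2 * t) {k : ℕ} {x : Fin n → ℝ} (hx : x ∈ U k) :
    t * volume (cell a ℓ k x) ≤ 2 * ∫⁻ y in cell a ℓ k x ∩ lastPart U k, h y := by
  set T : Set (Fin n → ℝ) := {y | y ∈ cell a ℓ k x ∧ ∃ i > k, y ∈ U i} with hT
  have h1 : t * volume (cell a ℓ k x) ≤ ∫⁻ y in cell a ℓ k x, h y := by
    rw [← cellAverage_mul_volume hℓ]; gcongr; exact hlow k x hx
  have h2 : ∫⁻ y in cell a ℓ k x, h y ≤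
      (∫⁻ y in T, h y) + ∫⁻ y in cell a ℓ k x ∩ lastPart U k, h y :=
    (lintegral_mono_set (cell_subset_union_lastPart hU hx)).trans
      (lintegral_union_le h _ _)
  -- The later members first met have `h`-average at most `2 * t` and fill at most a quarter of the
  -- cell, so they carry at most `t * volume (cell a ℓ k x) / 2`, half of the lower bound `h1`.
  have h3 : ∫⁻ y in T, h y ≤ 2 * t * volume T := by
    rw [← setLIntegral_const]
    refine setLIntegral_le_of_first (saturated_cell le_rfl x) hU.saturated ?_
    intro i _ y _ hyi _
    rw [setLIntegral_const, ← cellAverage_mul_volume hℓ]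
    gcongr
    exact hup i y hyi
  have h4 : 2 * (t * volume (cell a ℓ k x)) ≤ t * volume (cell a ℓ k x) +
      2 * ∫⁻ y in cell a ℓ k x ∩ lastPart U k, h y := by
    calc 2 * (t * volume (cell a ℓ k x))
        ≤ 2 * (2 * t * volume T + ∫⁻ y in cell a ℓ k x ∩ lastPart U k, h y) := by
          gcongr; exact h1.trans (h2.trans (by gcongr))
      _ = t * (4 * volume T) + 2 * ∫⁻ y in cell a ℓ k x ∩ lastPart U k, h y := by ring
      _ ≤ _ := by gcongr; exact hU.sparse k x hx
  rw [two_mul] at h4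
  exact (ENNReal.add_le_add_iff_left
    (ENNReal.mul_ne_top ht (volume_cell_ne_top hℓ k x))).1 h4

-- Hölder for the factors `h * w ^ (1 / p)` and `w ^ (-(1 / p))`. Where `w = 0` the second factor is
-- `∞`, and `h0` keeps the product equal to `h`.
omit hℓ in
theorem lintegral_le_weighted_holder {p q : ℝ} (hpq : p.HolderConjugate q)
    {w h : (Fin n → ℝ) → ℝ≥0∞} {μ : Measure (Fin n → ℝ)} (hw : AEMeasurable w μ)
    (hh : AEMeasurable h μ) (hwt : ∀ x, w x ≠ ∞) (h0 : ∀ x, w x = 0 → h x = 0) :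
    ∫⁻ y, h y ∂μ ≤ (∫⁻ y, h y ^ p * w y ∂μ) ^ (1 / p) * (∫⁻ y, w y ^ (1 - q) ∂μ) ^ (1 / q) := by
  have hp := hpq.pos
  have hq := hpq.symm.pos
  have := ENNReal.lintegral_mul_le_Lp_mul_Lq μ hpq (f := fun y => h y * w y ^ (1 / p))
    (g := fun y => w y ^ (-(1 / p))) (hh.mul (hw.pow_const _)) (hw.pow_const _)
  have e1 : ∀ y, ((fun y => h y * w y ^ (1 / p)) * fun y => w y ^ (-(1 / p))) y = h y := by
    intro y
    by_cases hy : w y = 0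
    · simp [h0 y hy]
    · simp only [Pi.mul_apply]
      rw [mul_assoc, ← ENNReal.rpow_add _ _ hy (hwt y), add_neg_cancel, ENNReal.rpow_zero, mul_one]
  have e2 : ∀ y, (h y * w y ^ (1 / p)) ^ p = h y ^ p * w y := by
    intro y
    rw [ENNReal.mul_rpow_of_nonneg _ _ hp.le, ← ENNReal.rpow_mul, one_div_mul_cancel hp.ne',
      ENNReal.rpow_one]
  have e3 : ∀ y, (w y ^ (-(1 / p))) ^ q = w y ^ (1 - q) := by
    intro y
    rw [← ENNReal.rpow_mul]
    congr 1
    have := hpq.mul_eq_add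
    field_simp; linarith
  simp only [e1, e2, e3] at this
  exact this

/-- The weak-type estimate for a sparse family on which the averages of `h` are comparable to `t`:
this is where the `A_p` condition enters. -/
theorem IsSparse.tsum_cellAverage_le_of_comparable (hU : IsSparse a ℓ U) {P : Set (Fin n → ℝ)}
    (hP : ∀ k, U k ⊆ P) {p q : ℝ} (hpq : p.HolderConjugate q) {w h : (Fin n → ℝ) → ℝ≥0∞}
    (hw : AEMeasurable w volume) (hh : AEMeasurable h volume) (hwt : ∀ x, w x ≠ ∞)
    (h0 : ∀ x, w x = 0 → h x = 0) {K : ℝ≥0∞}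
    (hK : ∀ k x, cellAverage a ℓ k w x *
      cellAverage a ℓ k (fun y => w y ^ (1 - q)) x ^ (p - 1) ≤ K) (hKt : K ≠ ∞)
    {t : ℝ≥0∞} (ht : t ≠ ∞) (hlow : ∀ k, ∀ x ∈ U k, t ≤ cellAverage a ℓ k h x)
    (hup : ∀ k, ∀ x ∈ U k, cellAverage a ℓ k h x ≤ 2 * t) :
    t ^ p * ∑' k, ∫⁻ y in U k, cellAverage a ℓ k w y ≤
      2 ^ p * K * ∫⁻ y in P, h y ^ p * w y := by
  have hp := hpq.pos
  have hc : (2 : ℝ≥0∞) ^ p * K ≠ ∞ :=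
    ENNReal.mul_ne_top (ENNReal.rpow_ne_top_of_nonneg hp.le ENNReal.ofNat_ne_top) hKt
  rw [← lintegral_const_mul' _ _ hc, ← ENNReal.tsum_mul_left]
  simp_rw [← lintegral_const_mul' _ _ (ENNReal.rpow_ne_top_of_nonneg hp.le ht)]
  refine tsum_setLIntegral_le_of_lastPart hU hP fun k x hx => ?_
  rw [lintegral_const_mul' _ _ (ENNReal.rpow_ne_top_of_nonneg hp.le ht),
    lintegral_const_mul' _ _ hc, setLIntegral_cell_cellAverage]
  have hmass := hU.mul_volume_le_two_mul_lintegral hℓ ht hlow hup hx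
  have hhol := lintegral_le_weighted_holder hpq
    (hw.restrict (s := cell a ℓ k x ∩ lastPart U k)) hh.restrict hwt h0
  have hσ : ∫⁻ y in cell a ℓ k x ∩ lastPart U k, w y ^ (1 - q) ≤
      cellAverage a ℓ k (fun y => w y ^ (1 - q)) x * volume (cell a ℓ k x) := by
    rw [cellAverage_mul_volume hℓ]
    exact lintegral_mono_set Set.inter_subset_left
  have hKx := hK k x
  have hv0 := volume_cell_ne_zero (a := a) hℓ k x
  have hvt := volume_cell_ne_top (a := a) hℓ k x
  set v := volume (cell a ℓ k x)
  set W := cellAverage a ℓ k w x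
  set S := cellAverage a ℓ k (fun y => w y ^ (1 - q)) x
  set Y := ∫⁻ y in cell a ℓ k x ∩ lastPart U k, h y ^ p * w y
  have hp1 : 0 ≤ p - 1 := hpq.sub_one_pos.le
  have hexp : 1 / q * p = p - 1 := by
    have := hpq.mul_eq_add
    have := hpq.symm.ne_zero
    field_simp; linarith
  -- Raised to the power `p` and multiplied by `W`, this becomes `t ^ p * W * v ≤ 2 ^ p * K * Y`, by
  -- `W * S ^ (p - 1) ≤ K` and cancellation of `v ^ (p - 1)`. The integral `Y` is only over the last
  -- part, so the bounds add up over disjoint sets.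
  have h1 : t * v ≤ 2 * (Y ^ (1 / p) * (S * v) ^ (1 / q)) := by
    refine hmass.trans ?_
    gcongr
    refine hhol.trans ?_
    gcongr
    exact hpq.symm.one_div_nonneg
  have h2 : t ^ p * v ^ p ≤ 2 ^ p * (Y * (S ^ (p - 1) * v ^ (p - 1))) := by
    have := ENNReal.rpow_le_rpow h1 hp.le
    rwa [ENNReal.mul_rpow_of_nonneg _ _ hp.le, ENNReal.mul_rpow_of_nonneg _ _ hp.le,
      ENNReal.mul_rpow_of_nonneg _ _ hp.le, ← ENNReal.rpow_mul, ← ENNReal.rpow_mul, hexp,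
      one_div_mul_cancel hp.ne', ENNReal.rpow_one, ENNReal.mul_rpow_of_nonneg _ _ hp1] at this
  have h3 : v ^ p = v * v ^ (p - 1) := by
    conv_rhs => rw [← ENNReal.rpow_one v, ← ENNReal.rpow_mul, one_mul]
    rw [← ENNReal.rpow_add _ _ hv0 hvt]; congr 1; ring
  have hvp0 : v ^ (p - 1) ≠ 0 := (ENNReal.rpow_pos (pos_iff_ne_zero.2 hv0) hvt).ne'
  have hvpt : v ^ (p - 1) ≠ ∞ := ENNReal.rpow_ne_top_of_nonneg hp1 hvt
  refine (ENNReal.mul_le_mul_iff_left hvp0 hvpt).1 ?_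
  calc t ^ p * (W * v) * v ^ (p - 1) = W * (t ^ p * v ^ p) := by rw [h3]; ring
    _ ≤ W * (2 ^ p * (Y * (S ^ (p - 1) * v ^ (p - 1)))) := by gcongr
    _ = (W * S ^ (p - 1)) * (2 ^ p * Y * v ^ (p - 1)) := by ring
    _ ≤ K * (2 ^ p * Y * v ^ (p - 1)) := by gcongr
    _ = _ := by ring

end SparseSums

/-! ### The sparse bilinear form, split by the size of the averages -/

noncomputable section BilinearForm

variable {n : ℕ} {a : Fin n → ℝ} {ℓ : ℝ} {U : ℕ → Set (Fin n → ℝ)}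

theorem ENNReal.exists_two_pow_slice {T u : ℝ≥0∞} (hT0 : T ≠ 0) (hTt : T ≠ ∞) (hu : u ≠ ∞)
    (h : T < u) : ∃ j : ℕ, T * 2 ^ j < u ∧ u ≤ T * 2 ^ (j + 1) := by
  classical
  have hex : ∃ j : ℕ, u ≤ T * 2 ^ j := by
    have h1 : u / T ≠ ∞ := (ENNReal.div_lt_top hu hT0).ne
    obtain ⟨m, hm⟩ := ENNReal.exists_nat_gt h1
    refine ⟨m, ?_⟩
    rw [mul_comm, ← ENNReal.div_le_iff hT0 hTt]
    refine hm.le.trans ?_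
    have : (m : ℕ) ≤ 2 ^ m := Nat.lt_two_pow_self.le
    exact_mod_cast this
  rcases hN : Nat.find hex with _ | j
  · have := Nat.find_spec hex
    rw [hN] at this
    simp only [pow_zero, mul_one] at this
    exact absurd h (not_lt.2 this)
  · refine ⟨j, ?_, ?_⟩
    · exact not_le.1 (Nat.find_min hex (by omega))
    · have := Nat.find_spec hex
      rwa [hN] at this

/-- From `log 2 ≥ 1 / 2` comes `2 ^ (p - 1) ≥ 1 + (p - 1) / 2`, hence `1 - 2 ^ (1 - p) ≥ (p - 1) /
(p + 1) ≥ 1 / (2 * q)`. This is the source of the factor `p'` in the theorem. -/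
theorem ENNReal.tsum_two_rpow_geometric_le {p q : ℝ} (hpq : p.HolderConjugate q) :
    ∑' j : ℕ, ((2 : ℝ≥0∞) ^ (1 - p)) ^ j ≤ 2 * ENNReal.ofReal q := by
  rw [ENNReal.tsum_geometric]
  have hs : 0 < p - 1 := hpq.sub_one_pos
  have hq := hpq.symm.pos
  have e : (2 : ℝ≥0∞) ^ (1 - p) = ENNReal.ofReal ((2 : ℝ) ^ (1 - p)) := by
    rw [← ENNReal.ofReal_rpow_of_pos (by norm_num)]; simp
  have hpos : (0 : ℝ) < 2 ^ (p - 1) := by positivity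
  have hlog : (1 : ℝ) / 2 ≤ Real.log 2 := by linarith [Real.log_two_gt_d9]
  have h2 : 1 + (p - 1) / 2 ≤ (2 : ℝ) ^ (p - 1) := by
    rw [Real.rpow_def_of_pos (by norm_num)]
    have := Real.add_one_le_exp (Real.log 2 * (p - 1))
    nlinarith
  have h3 : (2 : ℝ) ^ (1 - p) = (2 ^ (p - 1))⁻¹ := by
    rw [← Real.rpow_neg (by norm_num)]; congr 1; ring
  have hqe : q = p / (p - 1) := hpq.conjugate_eq
  have h4 : (2 * q)⁻¹ ≤ 1 - (2 : ℝ) ^ (1 - p) := by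
    have h5 : (2 : ℝ) ^ (1 - p) ≤ (1 + (p - 1) / 2)⁻¹ := by
      rw [h3]; gcongr
    have h6 : (2 * q)⁻¹ ≤ 1 - (1 + (p - 1) / 2)⁻¹ := by
      have hp := hpq.pos
      have e7 : (2 * q)⁻¹ = (p - 1) / (2 * p) := by rw [hqe]; field_simp
      have e8 : 1 - (1 + (p - 1) / 2)⁻¹ = (p - 1) / (p + 1) := by
        have : 1 + (p - 1) / 2 ≠ 0 := by positivity
        have : p + 1 ≠ 0 := by positivity
        field_simp; ring
      rw [e7, e8]
      gcongr
      linarith [hpq.lt]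
    linarith
  rw [e, ← ENNReal.ofReal_one, ← ENNReal.ofReal_sub _ (by positivity)]
  have h2q : (2 : ℝ≥0∞) * ENNReal.ofReal q = ENNReal.ofReal (2 * q) := by
    rw [ENNReal.ofReal_mul (by norm_num)]; simp
  rw [h2q, ENNReal.inv_le_iff_inv_le, ← ENNReal.ofReal_inv_of_pos (by positivity)]
  exact ENNReal.ofReal_le_ofReal h4

/-- Balancing the two terms of the layer-cake estimate. -/
theorem ENNReal.exists_balanced_level {p q : ℝ} (hpq : p.HolderConjugate q) {X D : ℝ≥0∞}
    (hX0 : X ≠ 0) (hXt : X ≠ ∞) (hD0 : D ≠ 0) (hDt : D ≠ ∞) :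
    ∃ T : ℝ≥0∞, T ≠ 0 ∧ T ≠ ∞ ∧ T * D = 2 * (X ^ (1 / p) * D ^ (1 / q)) ∧
      2 ^ (p + 1) * X * T ^ (1 - p) = 4 * (X ^ (1 / p) * D ^ (1 / q)) := by
  have hp := hpq.pos
  have hq := hpq.symm.pos
  have hpi : 0 < 1 / p := hpq.one_div_pos
  have e1 : 1 / q = 1 - 1 / p := by
    have := hpq.inv_add_inv_eq_one
    simp only [one_div]; linarith
  have hXp0 : X ^ (1 / p) ≠ 0 := (ENNReal.rpow_pos (pos_iff_ne_zero.2 hX0) hXt).ne'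
  have hXpt : X ^ (1 / p) ≠ ∞ := ENNReal.rpow_ne_top_of_nonneg hpi.le hXt
  have hDp0 : D ^ (-(1 / p)) ≠ 0 := (ENNReal.rpow_pos (pos_iff_ne_zero.2 hD0) hDt).ne'
  have hDpt : D ^ (-(1 / p)) ≠ ∞ := by
    rw [ENNReal.rpow_neg]
    exact ENNReal.inv_ne_top.2 (ENNReal.rpow_pos (pos_iff_ne_zero.2 hD0) hDt).ne'
  -- Up to the factor `2` this solves `T * D = X * T ^ (1 - p)`. The factor turns `2 ^ (p + 1)` into
  -- `2 ^ (p + 1) * 2 ^ (1 - p) = 4`, so no constant depends on `p`.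
  refine ⟨2 * (X ^ (1 / p) * D ^ (-(1 / p))), mul_ne_zero two_ne_zero (mul_ne_zero hXp0 hDp0),
    ENNReal.mul_ne_top ENNReal.ofNat_ne_top (ENNReal.mul_ne_top hXpt hDpt), ?_, ?_⟩
  · have : D ^ (1 / q) = D ^ (-(1 / p)) * D := by
      conv_rhs => rw [← ENNReal.rpow_one D, ← ENNReal.rpow_mul, one_mul]
      rw [← ENNReal.rpow_add _ _ hD0 hDt, e1]; congr 1; ring
    rw [this]; ring
  · have hab : X ^ (1 / p) * D ^ (-(1 / p)) ≠ ∞ := ENNReal.mul_ne_top hXpt hDpt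
    rw [ENNReal.mul_rpow_of_ne_top ENNReal.ofNat_ne_top hab, ENNReal.mul_rpow_of_ne_top hXpt hDpt,
      ← ENNReal.rpow_mul, ← ENNReal.rpow_mul]
    have e2 : (2 : ℝ≥0∞) ^ (p + 1) * 2 ^ (1 - p) = 4 := by
      rw [← ENNReal.rpow_add _ _ (by norm_num) ENNReal.ofNat_ne_top,
        show p + 1 + (1 - p) = (2 : ℕ) by push_cast; ring, ENNReal.rpow_natCast]
      norm_num
    have e3 : X * X ^ (1 / p * (1 - p)) = X ^ (1 / p) := by
      conv_lhs => rw [← ENNReal.rpow_one X, ← ENNReal.rpow_mul, one_mul]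
      rw [← ENNReal.rpow_add _ _ hX0 hXt]; congr 1; field_simp; ring
    have e4 : -(1 / p) * (1 - p) = 1 / q := by rw [e1]; field_simp; ring
    rw [e4]
    calc (2 : ℝ≥0∞) ^ (p + 1) * X * (2 ^ (1 - p) * (X ^ (1 / p * (1 - p)) * D ^ (1 / q)))
        = (2 ^ (p + 1) * 2 ^ (1 - p)) * (X * X ^ (1 / p * (1 - p))) * D ^ (1 / q) := by ring
      _ = _ := by rw [e2, e3]; ring

/-- The average of `w` is constant on each cell, so integrating `h` against it sees only the average
of `h` there. -/
theorem setLIntegral_cellAverage_mul (hℓ : 0 < ℓ) {k : ℕ} {B : Set (Fin n → ℝ)}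
    (hB : Saturated a ℓ k B) (w : (Fin n → ℝ) → ℝ≥0∞) {h : (Fin n → ℝ) → ℝ≥0∞}
    (hh : AEMeasurable h volume) :
    ∫⁻ y in B, cellAverage a ℓ k w y * h y =
      ∫⁻ y in B, cellAverage a ℓ k w y * cellAverage a ℓ k h y := by
  refine setLIntegral_eq_of_cell hB fun x _ => ?_
  rw [setLIntegral_cell_cellAverage_mul k w hh,
    setLIntegral_cell_cellAverage_mul k w (measurable_cellAverage k h).aemeasurable,
    setLIntegral_cell_cellAverage, cellAverage_mul_volume hℓ]

/-- The members of `U` over which `h` has average in `(T 2 ^ j, T 2 ^ (j + 1)]`. -/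
def averageSlice (a : Fin n → ℝ) (ℓ : ℝ) (U : ℕ → Set (Fin n → ℝ)) (h : (Fin n → ℝ) → ℝ≥0∞)
    (T : ℝ≥0∞) (j k : ℕ) : Set (Fin n → ℝ) :=
  {x | x ∈ U k ∧ T * 2 ^ j < cellAverage a ℓ k h x ∧ cellAverage a ℓ k h x ≤ T * 2 ^ (j + 1)}

theorem saturated_averageSlice (hU : IsSparse a ℓ U) (h : (Fin n → ℝ) → ℝ≥0∞) (T : ℝ≥0∞)
    (j k : ℕ) : Saturated a ℓ k (averageSlice a ℓ U h T j k) := by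
  rintro x ⟨hx, h1, h2⟩ y hy
  refine ⟨hU.saturated k x hx hy, ?_, ?_⟩ <;> rwa [cellAverage_eq_of_mem hy]

/-- An average of `h` is either at most `T` or, being finite, falls into one of the dyadic slices
above `T`. -/
theorem IsSparse.setLIntegral_cellAverage_mul_le (hℓ : 0 < ℓ) (hU : IsSparse a ℓ U)
    {w h : (Fin n → ℝ) → ℝ≥0∞} (hh : AEMeasurable h volume)
    (hht : ∀ k x, cellAverage a ℓ k h x ≠ ∞) {T : ℝ≥0∞} (hT0 : T ≠ 0) (hTt : T ≠ ∞) (k : ℕ) :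
    ∫⁻ y in U k, cellAverage a ℓ k w y * h y ≤ T * (∫⁻ y in U k, cellAverage a ℓ k w y) +
      ∑' j : ℕ, T * 2 ^ (j + 1) *
        ∫⁻ y in averageSlice a ℓ U h T j k, cellAverage a ℓ k w y := by
  have hwm := measurable_cellAverage (a := a) (ℓ := ℓ) k w
  have hSm : ∀ j, MeasurableSet (averageSlice a ℓ U h T j k) := fun j =>
    (saturated_averageSlice hU h T j k).measurableSet
  have hUm := (hU.saturated k).measurableSet
  have e : ∀ j, T * 2 ^ (j + 1) * ∫⁻ y in averageSlice a ℓ U h T j k, cellAverage a ℓ k w y =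
      ∫⁻ y in U k, (averageSlice a ℓ U h T j k).indicator
        (fun y => T * 2 ^ (j + 1) * cellAverage a ℓ k w y) y := by
    intro j
    have hsub : averageSlice a ℓ U h T j k ∩ U k = averageSlice a ℓ U h T j k :=
      Set.inter_eq_left.2 fun x hx => hx.1
    rw [setLIntegral_indicator (hSm j), hsub, lintegral_const_mul _ hwm]
  simp_rw [e]
  rw [setLIntegral_cellAverage_mul hℓ (hU.saturated k) w hh, ← lintegral_const_mul _ hwm,
    ← lintegral_tsum fun j => ((hwm.const_mul _).indicator (hSm j)).aemeasurable,
    ← lintegral_add_left (hwm.const_mul _)]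
  refine setLIntegral_mono' hUm fun y hy => ?_
  rcases le_or_gt (cellAverage a ℓ k h y) T with hle | hgt
  · refine le_add_right ?_
    rw [mul_comm]; gcongr
  · obtain ⟨j, hj1, hj2⟩ := ENNReal.exists_two_pow_slice hT0 hTt (hht k y) hgt
    refine le_add_left (le_trans ?_ (ENNReal.le_tsum j))
    rw [Set.indicator_of_mem (show y ∈ averageSlice a ℓ U h T j k from ⟨hy, hj1, hj2⟩), mul_comm]
    gcongr

/-- The bound for the bilinear sparse form `∑ w(P) ⨍_P h` in terms of the norm of `h` in `L^p(w)`. -/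
theorem IsSparse.bilinear_le (hℓ : 0 < ℓ) (hU : IsSparse a ℓ U) {P : Set (Fin n → ℝ)}
    (hP : ∀ k, U k ⊆ P) {p q : ℝ} (hpq : p.HolderConjugate q) {w h : (Fin n → ℝ) → ℝ≥0∞}
    (hw : AEMeasurable w volume) (hh : AEMeasurable h volume) (hwt : ∀ x, w x ≠ ∞)
    (h0 : ∀ x, w x = 0 → h x = 0) (hht : ∀ k x, cellAverage a ℓ k h x ≠ ∞) {K D : ℝ≥0∞}
    (hK : ∀ k x, cellAverage a ℓ k w x *
      cellAverage a ℓ k (fun y => w y ^ (1 - q)) x ^ (p - 1) ≤ K) (hK0 : K ≠ 0) (hKt : K ≠ ∞)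
    (hD : ∑' k, ∫⁻ y in U k, cellAverage a ℓ k w y ≤ D) (hD0 : D ≠ 0) (hDt : D ≠ ∞)
    (hX0 : ∫⁻ y in P, h y ^ p * w y ≠ 0) (hXt : ∫⁻ y in P, h y ^ p * w y ≠ ∞) :
    ∑' k, ∫⁻ y in U k, cellAverage a ℓ k w y * h y ≤
      10 * ENNReal.ofReal q * ((K * ∫⁻ y in P, h y ^ p * w y) ^ (1 / p) * D ^ (1 / q)) := by
  set X := ∫⁻ y in P, h y ^ p * w y
  obtain ⟨T, hT0, hTt, hTD, hTX⟩ := ENNReal.exists_balanced_level hpq (X := K * X)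
    (mul_ne_zero hK0 hX0) (ENNReal.mul_ne_top hKt hXt) hD0 hDt
  set N := (K * X) ^ (1 / p) * D ^ (1 / q)
  have hslice : ∀ j : ℕ, T * 2 ^ (j + 1) *
      ∑' k, ∫⁻ y in averageSlice a ℓ U h T j k, cellAverage a ℓ k w y ≤
      4 * N * ((2 : ℝ≥0∞) ^ (1 - p)) ^ j := by
    intro j
    have h2j : (2 : ℝ≥0∞) ^ j ≠ ∞ := ENNReal.pow_ne_top ENNReal.ofNat_ne_top
    have h2j0 : (2 : ℝ≥0∞) ^ j ≠ 0 := by simp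
    have ht0 : T * 2 ^ j ≠ 0 := mul_ne_zero hT0 h2j0
    have htt : T * 2 ^ j ≠ ∞ := ENNReal.mul_ne_top hTt h2j
    have hS : IsSparse a ℓ (averageSlice a ℓ U h T j) :=
      hU.mono (saturated_averageSlice hU h T j) fun k x hx => hx.1
    have key := hS.tsum_cellAverage_le_of_comparable hℓ (fun k x hx => hP k hx.1) hpq hw hh hwt h0
      hK hKt htt (fun k x hx => hx.2.1.le) (fun k x hx => hx.2.2.trans_eq (by ring))
    set φ := ∑' k, ∫⁻ y in averageSlice a ℓ U h T j k, cellAverage a ℓ k w y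
    -- With `t = T * 2 ^ j`, write `t = t ^ (1 - p) * t ^ p`: the factor `t ^ p` is absorbed by
    -- `key`, and `t ^ (1 - p)` decays geometrically in `j`.
    have e1 : T * 2 ^ (j + 1) = 2 * ((T * 2 ^ j) ^ (1 - p) * (T * 2 ^ j) ^ p) := by
      rw [← ENNReal.rpow_add _ _ ht0 htt, sub_add_cancel, ENNReal.rpow_one]; ring
    have e2 : (T * 2 ^ j) ^ (1 - p) = T ^ (1 - p) * ((2 : ℝ≥0∞) ^ (1 - p)) ^ j := by
      rw [ENNReal.mul_rpow_of_ne_top hTt h2j, ← ENNReal.rpow_natCast, ← ENNReal.rpow_natCast,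
        ← ENNReal.rpow_mul, ← ENNReal.rpow_mul, mul_comm (j : ℝ)]
    have e3 : (2 : ℝ≥0∞) ^ (p + 1) = 2 * 2 ^ p := by
      rw [ENNReal.rpow_add _ _ (by norm_num) ENNReal.ofNat_ne_top, ENNReal.rpow_one, mul_comm]
    calc T * 2 ^ (j + 1) * φ = 2 * (T * 2 ^ j) ^ (1 - p) * ((T * 2 ^ j) ^ p * φ) := by
          rw [e1]; ring
      _ ≤ 2 * (T * 2 ^ j) ^ (1 - p) * (2 ^ p * K * X) := by gcongr
      _ = (2 ^ (p + 1) * (K * X) * T ^ (1 - p)) * ((2 : ℝ≥0∞) ^ (1 - p)) ^ j := by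
          rw [e2, e3]; ring
      _ = _ := by rw [hTX]
  -- Since `q ≥ 1`, the low-level term `2 * N` is absorbed into the high-level one: `2 * N + 8 * N *
  -- q ≤ 10 * N * q`.
  have hq1 : 1 ≤ ENNReal.ofReal q := by
    rw [ENNReal.one_le_ofReal]; exact hpq.symm.lt.le
  calc ∑' k, ∫⁻ y in U k, cellAverage a ℓ k w y * h y
      ≤ ∑' k, (T * (∫⁻ y in U k, cellAverage a ℓ k w y) + ∑' j : ℕ, T * 2 ^ (j + 1) *
        ∫⁻ y in averageSlice a ℓ U h T j k, cellAverage a ℓ k w y) :=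
        ENNReal.tsum_le_tsum fun k => hU.setLIntegral_cellAverage_mul_le hℓ hh hht hT0 hTt k
    _ = T * (∑' k, ∫⁻ y in U k, cellAverage a ℓ k w y) + ∑' j : ℕ, T * 2 ^ (j + 1) *
        ∑' k, ∫⁻ y in averageSlice a ℓ U h T j k, cellAverage a ℓ k w y := by
        rw [ENNReal.tsum_add, ENNReal.tsum_mul_left, ENNReal.tsum_comm]
        simp_rw [ENNReal.tsum_mul_left]
    _ ≤ T * D + ∑' j : ℕ, 4 * N * ((2 : ℝ≥0∞) ^ (1 - p)) ^ j := by
        exact add_le_add (mul_le_mul' le_rfl hD) (ENNReal.tsum_le_tsum hslice)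
    _ ≤ 2 * N + 4 * N * (2 * ENNReal.ofReal q) := by
        rw [hTD, ENNReal.tsum_mul_left]
        gcongr
        exact ENNReal.tsum_two_rpow_geometric_le hpq
    _ ≤ 2 * N * ENNReal.ofReal q + 4 * N * (2 * ENNReal.ofReal q) := by
        exact add_le_add (le_mul_of_one_le_right' hq1) le_rfl
    _ = _ := by ring

end BilinearForm

/-! ### The stopping family of a function and the sparse domination of its oscillation -/

noncomputable section Stopping

variable {n : ℕ} (a : Fin n → ℝ) (ℓ : ℝ)

/-- The mean of `f` over the cell of level `k` containing `x`. -/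
def cellMean (k : ℕ) (f : (Fin n → ℝ) → ℝ) (x : Fin n → ℝ) : ℝ := ⨍ y in cell a ℓ k x, f y

/-- The mean oscillation of `f` over the cell of level `k` containing `x`. -/
def cellOsc (k : ℕ) (f : (Fin n → ℝ) → ℝ) (x : Fin n → ℝ) : ℝ≥0∞ :=
  cellAverage a ℓ k (fun y => ‖f y - cellMean a ℓ k f x‖ₑ) x

open Classical in
/-- The level of the last stopping cell containing `x` among the levels up to `k`: a cell is
selected when the average distance of `f` from its mean over the previous selected cell exceeds
four times the oscillation there. -/
def stopLevel (f : (Fin n → ℝ) → ℝ) : ℕ → (Fin n → ℝ) → ℕ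
  | 0, _ => 0
  | k + 1, x =>
    if 4 * cellOsc a ℓ (stopLevel f k x) f x <
      cellAverage a ℓ (k + 1) (fun y => ‖f y - cellMean a ℓ (stopLevel f k x) f x‖ₑ) x
    then k + 1 else stopLevel f k x

/-- The union of the selected cells of level `k`. -/
def stopFamily (f : (Fin n → ℝ) → ℝ) (k : ℕ) : Set (Fin n → ℝ) := {x | stopLevel a ℓ f k x = k}

variable {a ℓ} {f : (Fin n → ℝ) → ℝ}

theorem cellMean_eq_of_mem {k : ℕ} {x y : Fin n → ℝ} (h : y ∈ cell a ℓ k x) :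
    cellMean a ℓ k f y = cellMean a ℓ k f x := by
  simp only [cellMean, cell_eq_of_mem h]

theorem cellOsc_eq_of_mem {k : ℕ} {x y : Fin n → ℝ} (h : y ∈ cell a ℓ k x) :
    cellOsc a ℓ k f y = cellOsc a ℓ k f x := by
  simp only [cellOsc, cellMean_eq_of_mem h, cellAverage_eq_of_mem h]

theorem stopLevel_le (k : ℕ) (x : Fin n → ℝ) : stopLevel a ℓ f k x ≤ k := by
  induction k with
  | zero => simp [stopLevel]
  | succ k ih =>
    rw [stopLevel]
    split_ifs
    · exact le_rfl
    · omega

theorem stopLevel_eq_of_mem {k : ℕ} {x y : Fin n → ℝ} (h : y ∈ cell a ℓ k x) :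
    stopLevel a ℓ f k y = stopLevel a ℓ f k x := by
  induction k with
  | zero => simp [stopLevel]
  | succ k ih =>
    have ih' := ih (cell_succ_subset k x h)
    have hc : y ∈ cell a ℓ (stopLevel a ℓ f k x) x :=
      cell_subset_of_le ((stopLevel_le k x).trans k.le_succ) x h
    rw [stopLevel, stopLevel, ih', cellOsc_eq_of_mem hc, cellMean_eq_of_mem hc,
      cellAverage_eq_of_mem h]

theorem saturated_stopFamily (k : ℕ) : Saturated a ℓ k (stopFamily a ℓ f k) :=
  fun _ hx _ hy => (stopLevel_eq_of_mem hy).trans hx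

theorem mem_stopFamily_stopLevel (k : ℕ) (x : Fin n → ℝ) :
    x ∈ stopFamily a ℓ f (stopLevel a ℓ f k x) := by
  induction k with
  | zero => simp [stopFamily, stopLevel]
  | succ k ih =>
    by_cases h : 4 * cellOsc a ℓ (stopLevel a ℓ f k x) f x <
      cellAverage a ℓ (k + 1) (fun y => ‖f y - cellMean a ℓ (stopLevel a ℓ f k x) f x‖ₑ) x
    · have : stopLevel a ℓ f (k + 1) x = k + 1 := by rw [stopLevel, if_pos h]
      rw [this]; exact this
    · have : stopLevel a ℓ f (k + 1) x = stopLevel a ℓ f k x := by rw [stopLevel, if_neg h]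
      rwa [this]

/-- Along the cells containing `x` the stopping level is nondecreasing and takes only selected
values, so it cannot leave `k` without meeting a selected cell. -/
theorem stopLevel_eq_of_forall_notMem {k : ℕ} {x : Fin n → ℝ} (hk : x ∈ stopFamily a ℓ f k) {j : ℕ}
    (hkj : k ≤ j) (h : ∀ i, k < i → i ≤ j → x ∉ stopFamily a ℓ f i) :
    stopLevel a ℓ f j x = k := by
  have h1 := mem_stopFamily_stopLevel (a := a) (ℓ := ℓ) (f := f) j x
  have hmono : Monotone fun j => stopLevel a ℓ f j x := by
    refine monotone_nat_of_le_succ fun i => ?_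
    rw [stopLevel]
    split_ifs
    · exact (stopLevel_le i x).trans i.le_succ
    · exact le_rfl
  have h2 : k ≤ stopLevel a ℓ f j x := (show stopLevel a ℓ f k x = k from hk).symm.trans_le (hmono hkj)
  by_contra hne
  exact h _ (lt_of_le_of_ne h2 (Ne.symm hne)) (stopLevel_le j x) h1

/-- The stopping condition satisfied by the first selected cells inside a selected cell. -/
theorem lt_cellAverage_of_first {k i : ℕ} {x y : Fin n → ℝ} (hx : x ∈ stopFamily a ℓ f k)
    (hy : y ∈ cell a ℓ k x) (hki : k < i) (hyi : y ∈ stopFamily a ℓ f i)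
    (hfirst : ∀ j, k < j → j < i → y ∉ stopFamily a ℓ f j) :
    4 * cellOsc a ℓ k f x < cellAverage a ℓ i (fun z => ‖f z - cellMean a ℓ k f x‖ₑ) y := by
  obtain ⟨j, rfl⟩ : ∃ j, i = j + 1 := ⟨i - 1, by omega⟩
  have hj : stopLevel a ℓ f j y = k :=
    stopLevel_eq_of_forall_notMem (saturated_stopFamily k x hx hy) (by omega)
      fun i h1 h2 => hfirst i h1 (by omega)
  have hyi' : stopLevel a ℓ f (j + 1) y = j + 1 := hyi
  rw [stopLevel, hj, cellOsc_eq_of_mem hy, cellMean_eq_of_mem hy] at hyi'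
  by_contra hcon
  rw [if_neg hcon] at hyi'
  omega

variable (hℓ : 0 < ℓ) (hf : LocallyIntegrable f volume)
include hℓ hf

theorem integrableOn_cell (k : ℕ) (x : Fin n → ℝ) : IntegrableOn f (cell a ℓ k x) :=
  (hf.integrableOn_isCompact isCompact_Icc).mono_set (cell_subset_closedCell hℓ k x)

theorem cellOsc_ne_top (k : ℕ) (x : Fin n → ℝ) : cellOsc a ℓ k f x ≠ ∞ := by
  rw [cellOsc, cellAverage, setLAverage_eq]
  refine (ENNReal.div_lt_top ?_ (volume_cell_ne_zero hℓ k x)).ne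
  have hc : IntegrableOn (fun _ => cellMean a ℓ k f x) (cell a ℓ k x) :=
    integrableOn_const (volume_cell_ne_top hℓ k x)
  exact ((integrableOn_cell hℓ hf k x).sub hc).hasFiniteIntegral.ne

/-- Chebyshev: on the first selected cells inside `P`, with union `T`, the stopping condition
integrates to `4 osc(P) |T| ≤ ∫_T |f - f_P| ≤ osc(P) |P|`. -/
theorem isSparse_stopFamily : IsSparse a ℓ (stopFamily a ℓ f) where
  saturated := saturated_stopFamily
  sparse k x hx := by
    set T : Set (Fin n → ℝ) := {y | y ∈ cell a ℓ k x ∧ ∃ i > k, y ∈ stopFamily a ℓ f i}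
    have hcell : Saturated a ℓ k (cell a ℓ k x) := saturated_cell le_rfl x
    -- Zero oscillation cannot be cancelled. But then `f` is almost everywhere constant on the cell,
    -- and the strict stopping inequality excludes any later selected cell.
    by_cases h0 : cellOsc a ℓ k f x = 0
    · have : ∫⁻ _ in T, 1 ≤ ∫⁻ _ in T, 0 := by
        refine setLIntegral_le_of_first hcell saturated_stopFamily fun i hi y hy hyi hfi => ?_
        exfalso
        have h1 := lt_cellAverage_of_first hx hy hi hyi hfi
        have h2 : cellAverage a ℓ i (fun z => ‖f z - cellMean a ℓ k f x‖ₑ) y *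
            volume (cell a ℓ i y) ≤ 0 := by
          rw [cellAverage_mul_volume hℓ]
          calc ∫⁻ z in cell a ℓ i y, ‖f z - cellMean a ℓ k f x‖ₑ
              ≤ ∫⁻ z in cell a ℓ k x, ‖f z - cellMean a ℓ k f x‖ₑ :=
                lintegral_mono_set (hcell.of_le hi.le y hy)
            _ = cellOsc a ℓ k f x * volume (cell a ℓ k x) := (cellAverage_mul_volume hℓ _ _ _).symm
            _ ≤ 0 := by rw [h0, zero_mul]
        rcases mul_eq_zero.1 (le_zero_iff.1 h2) with h3 | h3
        · rw [h3] at h1; exact not_lt_zero h1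
        · exact volume_cell_ne_zero hℓ i y h3
      have hT : volume T ≤ 0 := by simpa using this
      rw [le_zero_iff.1 hT, mul_zero]
      exact zero_le
    · have h1 : 4 * cellOsc a ℓ k f x * volume T ≤ ∫⁻ z in T, ‖f z - cellMean a ℓ k f x‖ₑ := by
        rw [← setLIntegral_const]
        refine setLIntegral_le_of_first hcell saturated_stopFamily fun i hi y hy hyi hfi => ?_
        rw [setLIntegral_const, ← cellAverage_mul_volume hℓ]
        gcongr
        exact (lt_cellAverage_of_first hx hy hi hyi hfi).le
      have h2 : ∫⁻ z in T, ‖f z - cellMean a ℓ k f x‖ₑ ≤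
          cellOsc a ℓ k f x * volume (cell a ℓ k x) := by
        rw [cellOsc, cellAverage_mul_volume hℓ]
        exact lintegral_mono_set fun y hy => hy.1
      have h3 := h1.trans h2
      rw [mul_comm 4, mul_assoc] at h3
      exact (ENNReal.mul_le_mul_iff_right h0 (cellOsc_ne_top hℓ hf k x)).1 h3

theorem enorm_cellMean_sub_le (k : ℕ) (x : Fin n → ℝ) (c : ℝ) :
    ‖cellMean a ℓ k f x - c‖ₑ ≤ cellAverage a ℓ k (fun y => ‖f y - c‖ₑ) x := by
  have hv0 := volume_cell_ne_zero (a := a) hℓ k x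
  have hvt := volume_cell_ne_top (a := a) hℓ k x
  have : IsFiniteMeasure (volume.restrict (cell a ℓ k x)) := ⟨by simpa using hvt.lt_top⟩
  have : NeZero (volume.restrict (cell a ℓ k x)) := ⟨by simpa using hv0⟩
  have hfi : Integrable f (((volume.restrict (cell a ℓ k x)) Set.univ)⁻¹ •
      volume.restrict (cell a ℓ k x)) := (integrableOn_cell hℓ hf k x).to_average
  have e : cellMean a ℓ k f x - c = ⨍ y in cell a ℓ k x, (f y - c) := by
    rw [cellMean, average, average, integral_sub hfi (integrable_const c), integral_const,
      probReal_univ, one_smul]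
  rw [e]
  exact enorm_integral_le_lintegral_enorm _

/-- Telescope the means along the selected cells containing `x`. The parent of a newly selected cell
is still below the threshold `4 * cellOsc`, and passing to the child costs a factor `2 ^ n`. -/
theorem enorm_cellMean_sub_cellMean_zero_le (k : ℕ) (x : Fin n → ℝ) :
    ‖cellMean a ℓ k f x - cellMean a ℓ 0 f x‖ₑ ≤
      4 * 2 ^ n * ∑' i, (stopFamily a ℓ f i).indicator (cellOsc a ℓ i f) x := by
  set S : ℕ → ℝ≥0∞ := fun i => (stopFamily a ℓ f i).indicator (cellOsc a ℓ i f) x with hS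
  have hSlevel : ∀ k, S (stopLevel a ℓ f k x) = cellOsc a ℓ (stopLevel a ℓ f k x) f x := fun k =>
    Set.indicator_of_mem (mem_stopFamily_stopLevel k x) _
  have h2n : (1 : ℝ≥0∞) ≤ 2 ^ n := one_le_pow₀ (by norm_num)
  -- The second conjunct is the induction invariant: the current cell is below the threshold of the
  -- last selected one. The sum in the first stops before that last cell, whose oscillation pays for
  -- the next jump.
  have key : ‖cellMean a ℓ (stopLevel a ℓ f k x) f x - cellMean a ℓ 0 f x‖ₑ ≤
        4 * 2 ^ n * ∑ i ∈ Finset.range (stopLevel a ℓ f k x), S i ∧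
      cellAverage a ℓ k (fun y => ‖f y - cellMean a ℓ (stopLevel a ℓ f k x) f x‖ₑ) x ≤
        4 * cellOsc a ℓ (stopLevel a ℓ f k x) f x := by
    induction k with
    | zero =>
      refine ⟨by simp [stopLevel], ?_⟩
      change cellOsc a ℓ 0 f x ≤ _
      exact le_mul_of_one_le_left' (by norm_num)
    | succ k ih =>
      by_cases h : 4 * cellOsc a ℓ (stopLevel a ℓ f k x) f x <
        cellAverage a ℓ (k + 1) (fun y => ‖f y - cellMean a ℓ (stopLevel a ℓ f k x) f x‖ₑ) x
      · have e : stopLevel a ℓ f (k + 1) x = k + 1 := by rw [stopLevel, if_pos h]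
        rw [e]
        refine ⟨?_, le_mul_of_one_le_left' (by norm_num)⟩
        have hck := stopLevel_le (a := a) (ℓ := ℓ) (f := f) k x
        have hlevel := hSlevel k
        set c := stopLevel a ℓ f k x
        have h1 : ‖cellMean a ℓ (k + 1) f x - cellMean a ℓ c f x‖ₑ ≤ 4 * 2 ^ n * S c := by
          calc _ ≤ _ := enorm_cellMean_sub_le hℓ hf (k + 1) x _
            _ ≤ 2 ^ n * cellAverage a ℓ k (fun y => ‖f y - cellMean a ℓ c f x‖ₑ) x :=
              setLAverage_cell_succ_le hℓ _ k x
            _ ≤ 2 ^ n * (4 * S c) := by rw [hlevel]; gcongr; exact ih.2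
            _ = _ := by ring
        calc ‖cellMean a ℓ (k + 1) f x - cellMean a ℓ 0 f x‖ₑ
            = ‖(cellMean a ℓ c f x - cellMean a ℓ 0 f x) +
                (cellMean a ℓ (k + 1) f x - cellMean a ℓ c f x)‖ₑ := by congr 1; ring
          _ ≤ _ := enorm_add_le _ _
          _ ≤ 4 * 2 ^ n * ∑ i ∈ Finset.range c, S i + 4 * 2 ^ n * S c := add_le_add ih.1 h1
          _ = 4 * 2 ^ n * ∑ i ∈ Finset.range (c + 1), S i := by
            rw [Finset.sum_range_succ, mul_add]
          _ ≤ _ := by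
            gcongr
      · have e : stopLevel a ℓ f (k + 1) x = stopLevel a ℓ f k x := by rw [stopLevel, if_neg h]
        rw [e]
        exact ⟨ih.1, not_lt.1 h⟩
  have hlevel := hSlevel k
  set c := stopLevel a ℓ f k x
  calc ‖cellMean a ℓ k f x - cellMean a ℓ 0 f x‖ₑ
      = ‖(cellMean a ℓ c f x - cellMean a ℓ 0 f x) +
          (cellMean a ℓ k f x - cellMean a ℓ c f x)‖ₑ := by congr 1; ring
    _ ≤ _ := enorm_add_le _ _
    _ ≤ 4 * 2 ^ n * ∑ i ∈ Finset.range c, S i + 4 * 2 ^ n * S c := by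
      refine add_le_add key.1 ((enorm_cellMean_sub_le hℓ hf k x _).trans (key.2.trans ?_))
      rw [hlevel]
      gcongr
      exact le_mul_of_one_le_right' h2n
    _ = 4 * 2 ^ n * ∑ i ∈ Finset.range (c + 1), S i := by
      rw [Finset.sum_range_succ, mul_add]
    _ ≤ _ := by
      gcongr
      exact ENNReal.sum_le_tsum _

/-- Sparse domination of the oscillation of `f` by its stopping family. -/
theorem ae_enorm_sub_cellMean_zero_le : ∀ᵐ x, ‖f x - cellMean a ℓ 0 f x‖ₑ ≤
    4 * 2 ^ n * ∑' i, (stopFamily a ℓ f i).indicator (cellOsc a ℓ i f) x := by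
  filter_upwards [ae_tendsto_average_cell (a := a) hℓ hf] with x hx
  have h1 : Filter.Tendsto (fun k => ‖cellMean a ℓ k f x - cellMean a ℓ 0 f x‖ₑ) Filter.atTop
      (nhds ‖f x - cellMean a ℓ 0 f x‖ₑ) := (hx.sub_const _).enorm
  exact le_of_tendsto h1 (Filter.Eventually.of_forall fun k =>
    enorm_cellMean_sub_cellMean_zero_le hℓ hf k x)

end Stopping

/-! ### The weighted estimate over a cube -/

noncomputable section WeightedEstimate

variable {n : ℕ} {w f : (Fin n → ℝ) → ℝ}

theorem weightMeasure_apply {S : Set (Fin n → ℝ)} (hS : MeasurableSet S) :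
    weightMeasure w S = ∫⁻ x in S, ENNReal.ofReal (w x) := withDensity_apply _ hS

theorem IsCube.measurableSet {Q : Set (Fin n → ℝ)} (hQ : IsCube Q) : MeasurableSet Q := by
  obtain ⟨a, ℓ, _, rfl⟩ := hQ
  exact measurableSet_Icc

theorem IsWeight.aemeasurable_ofReal (hw : IsWeight w) :
    AEMeasurable (fun x => ENNReal.ofReal (w x)) volume :=
  hw.locallyIntegrable.aestronglyMeasurable.aemeasurable.ennreal_ofReal

theorem IsWeight.weightMeasure_ne_top (hw : IsWeight w) {Q : Set (Fin n → ℝ)} (hQ : IsCube Q) :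
    weightMeasure w Q ≠ ∞ := by
  rw [weightMeasure_apply hQ.measurableSet]
  obtain ⟨a, ℓ, _, rfl⟩ := hQ
  have hi := (hw.locallyIntegrable.integrableOn_isCompact
    (isCompact_Icc (a := a) (b := fun i => a i + ℓ))).hasFiniteIntegral
  refine ne_top_of_le_ne_top hi.ne (lintegral_mono fun x => ?_)
  rw [← ofReal_norm]
  exact ENNReal.ofReal_le_ofReal (le_abs_self _)

theorem lintegral_enorm_sub_le_bmoNorm (hβ : bmoNorm w f ≠ ∞) (hw : IsWeight w)
    {Q : Set (Fin n → ℝ)} (hQ : IsCube Q) :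
    ∫⁻ x in Q, ‖f x - ⨍ y in Q, f y‖ₑ ≤ bmoNorm w f * weightMeasure w Q := by
  have h : (∫⁻ x in Q, ‖f x - ⨍ y in Q, f y‖ₑ) / weightMeasure w Q ≤ bmoNorm w f :=
    le_iSup₂ (f := fun (Q : Set (Fin n → ℝ)) (_ : IsCube Q) =>
      (∫⁻ x in Q, ‖f x - ⨍ y in Q, f y‖ₑ) / weightMeasure w Q) Q hQ
  exact (ENNReal.div_le_iff_le_mul (Or.inr hβ) (Or.inl (hw.weightMeasure_ne_top hQ))).1 h

theorem lintegral_hlMaximal_le {Q : Set (Fin n → ℝ)} (hQ : IsCube Q)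
    (h0 : weightMeasure w Q ≠ 0) (hw : IsWeight w) :
    ∫⁻ x in Q, hlMaximal (Q.indicator w) x ≤ aInftyConst w * weightMeasure w Q := by
  have h : (∫⁻ x in Q, hlMaximal (Q.indicator w) x) / weightMeasure w Q ≤ aInftyConst w :=
    le_iSup₂ (f := fun (Q : Set (Fin n → ℝ)) (_ : IsCube Q) =>
      (∫⁻ x in Q, hlMaximal (Q.indicator w) x) / weightMeasure w Q) Q hQ
  exact (ENNReal.div_le_iff_le_mul (Or.inl h0) (Or.inl (hw.weightMeasure_ne_top hQ))).1 h

/-- On a cube of positive mass both averages are nonzero, as a negative power of a finite number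
never vanishes. Balancing the level `T` requires this. -/
theorem apConst_ne_zero {p : ℝ} (hp : 1 < p) (hw : IsWeight w) {Q : Set (Fin n → ℝ)}
    (hQ : IsCube Q) (h0 : weightMeasure w Q ≠ 0) : apConst p w ≠ 0 := by
  have hv : volume Q ≠ 0 := fun h => h0 (withDensity_absolutelyContinuous _ _ h)
  have hvt : volume Q ≠ ∞ := by
    obtain ⟨a, ℓ, _, rfl⟩ := hQ
    exact isCompact_Icc.measure_lt_top.ne
  have hq : 1 < p.conjExponent := (Real.HolderConjugate.conjExponent hp).symm.lt
  have hσ : ∫⁻ x in Q, ENNReal.ofReal (w x) ^ (1 - p.conjExponent) ≠ 0 := by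
    intro h
    rw [lintegral_eq_zero_iff' (hw.aemeasurable_ofReal.pow_const _).restrict] at h
    have h' : ∀ᵐ _ ∂volume.restrict Q, False := by
      filter_upwards [h] with x hx
      simp only [Pi.zero_apply, ENNReal.rpow_eq_zero_iff, ENNReal.ofReal_ne_top, false_and,
        or_false] at hx
      linarith [hx.2]
    rw [Filter.eventually_false_iff_eq_bot, ae_eq_bot, Measure.restrict_eq_zero] at h'
    exact hv h'
  have hle : (⨍⁻ x in Q, ENNReal.ofReal (w x) ∂volume) *
      (⨍⁻ x in Q, ENNReal.ofReal (w x) ^ (1 - p.conjExponent) ∂volume) ^ (p - 1) ≤ apConst p w :=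
    le_iSup₂ (f := fun (Q : Set (Fin n → ℝ)) (_ : IsCube Q) =>
      (⨍⁻ x in Q, ENNReal.ofReal (w x) ∂volume) *
      (⨍⁻ x in Q, ENNReal.ofReal (w x) ^ (1 - p.conjExponent) ∂volume) ^ (p - 1)) Q hQ
  refine fun hz => absurd (le_zero_iff.1 (hle.trans_eq hz)) (mul_ne_zero ?_ ?_)
  · rw [setLAverage_eq, ← weightMeasure_apply hQ.measurableSet]
    exact ENNReal.div_ne_zero.2 ⟨h0, hvt⟩
  · intro hz'
    rcases ENNReal.rpow_eq_zero_iff.1 hz' with ⟨h1, _⟩ | ⟨_, h2⟩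
    · rw [setLAverage_eq] at h1
      exact ENNReal.div_ne_zero.2 ⟨hσ, hvt⟩ h1
    · linarith

variable {a : Fin n → ℝ} {ℓ : ℝ} (hℓ : 0 < ℓ)
include hℓ

theorem cellMean_eq_closedCell (k : ℕ) (x : Fin n → ℝ) :
    cellMean a ℓ k f x = ⨍ y in closedCell a ℓ k x, f y :=
  setAverage_congr (cell_ae_eq hℓ k x)

theorem cellOsc_le_bmoNorm (hβ : bmoNorm w f ≠ ∞) (hw : IsWeight w) (k : ℕ) (x : Fin n → ℝ) :
    cellOsc a ℓ k f x ≤ bmoNorm w f * cellAverage a ℓ k (fun y => ENNReal.ofReal (w y)) x := by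
  have hQ := isCube_closedCell (a := a) hℓ k x
  have h := lintegral_enorm_sub_le_bmoNorm hβ hw hQ
  rw [weightMeasure_apply hQ.measurableSet, ← cellMean_eq_closedCell hℓ,
    ← Measure.restrict_congr_set (cell_ae_eq hℓ k x)] at h
  simp only [cellOsc, cellAverage, setLAverage_eq]
  rw [← mul_div_assoc]
  gcongr

theorem cellAverage_mul_rpow_le_apConst {p : ℝ} (k : ℕ) (x : Fin n → ℝ) :
    cellAverage a ℓ k (fun y => ENNReal.ofReal (w y)) x *
      cellAverage a ℓ k (fun y => ENNReal.ofReal (w y) ^ (1 - p.conjExponent)) x ^ (p - 1) ≤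
    apConst p w := by
  simp only [cellAverage, setLAverage_cell_eq_closedCell hℓ]
  exact le_iSup₂ (f := fun (Q : Set (Fin n → ℝ)) (_ : IsCube Q) =>
    (⨍⁻ x in Q, ENNReal.ofReal (w x) ∂volume) *
      (⨍⁻ x in Q, ENNReal.ofReal (w x) ^ (1 - p.conjExponent) ∂volume) ^ (p - 1))
    (closedCell a ℓ k x) (isCube_closedCell hℓ k x)

theorem cellAverage_le_hlMaximal (hw : IsWeight w) {k : ℕ} {x : Fin n → ℝ} {Q : Set (Fin n → ℝ)}
    (hQ : cell a ℓ k x ⊆ Q) :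
    cellAverage a ℓ k (fun y => ENNReal.ofReal (w y)) x ≤ hlMaximal (Q.indicator w) x := by
  have h1 : cellAverage a ℓ k (fun y => ENNReal.ofReal (w y)) x =
      cellAverage a ℓ k (fun y => ‖Q.indicator w y‖ₑ) x := by
    simp only [cellAverage, setLAverage_eq]
    congr 1
    refine setLIntegral_congr_fun (measurableSet_cell k x) fun y hy => ?_
    simp only [Set.indicator_of_mem (hQ hy), Real.enorm_of_nonneg (hw.nonneg y)]
  rw [h1, cellAverage, setLAverage_cell_eq_closedCell hℓ]
  exact le_iSup_of_le (closedCell a ℓ k x) (le_iSup_of_le (isCube_closedCell hℓ k x)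
    (le_iSup_of_le (cell_subset_closedCell hℓ k x (mem_cell_self k x)) le_rfl))

theorem ae_enorm_sub_le_tsum_weight (hf : LocallyIntegrable f volume) (hβ : bmoNorm w f ≠ ∞)
    (hw : IsWeight w) : ∀ᵐ x, ‖f x - cellMean a ℓ 0 f x‖ₑ ≤ 4 * 2 ^ n * bmoNorm w f *
      ∑' i, (stopFamily a ℓ f i).indicator
        (cellAverage a ℓ i fun y => ENNReal.ofReal (w y)) x := by
  filter_upwards [ae_enorm_sub_cellMean_zero_le (a := a) hℓ hf] with x hx
  refine hx.trans ?_
  rw [mul_assoc _ (bmoNorm w f), ← ENNReal.tsum_mul_left (a := bmoNorm w f)]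
  gcongr with i
  by_cases hi : x ∈ stopFamily a ℓ f i
  · rw [Set.indicator_of_mem hi, Set.indicator_of_mem hi]
    exact cellOsc_le_bmoNorm hℓ hβ hw i x
  · rw [Set.indicator_of_notMem hi]; exact zero_le

/-- Duality form of the weighted estimate. -/
theorem setLIntegral_enorm_sub_mul_le {p : ℝ} (hp : 1 < p) (hf : LocallyIntegrable f volume)
    (hβ : bmoNorm w f ≠ ∞) (hw : IsWeight w) (hK : apConst p w ≠ ∞) (hA : aInftyConst w ≠ ∞)
    (hQ0 : weightMeasure w (closedCell a ℓ 0 a) ≠ 0) {h : (Fin n → ℝ) → ℝ≥0∞}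
    (hh : AEMeasurable h volume) (h0 : ∀ x, w x = 0 → h x = 0) {B : ℝ≥0∞} (hB : B ≠ ∞)
    (hhB : ∀ x, h x ≤ B)
    (hX0 : ∫⁻ y in cell a ℓ 0 a, h y ^ p * ENNReal.ofReal (w y) ≠ 0)
    (hXt : ∫⁻ y in cell a ℓ 0 a, h y ^ p * ENNReal.ofReal (w y) ≠ ∞) :
    ∫⁻ x in cell a ℓ 0 a, ‖f x - cellMean a ℓ 0 f a‖ₑ * h x ≤
      80 * 2 ^ n * bmoNorm w f * ENNReal.ofReal p.conjExponent * (apConst p w ^ (1 / p) *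
        (∫⁻ y in cell a ℓ 0 a, h y ^ p * ENNReal.ofReal (w y)) ^ (1 / p) *
        (aInftyConst w ^ (1 / p.conjExponent) *
          weightMeasure w (closedCell a ℓ 0 a) ^ (1 / p.conjExponent))) := by
  have hpq := Real.HolderConjugate.conjExponent hp
  set q := p.conjExponent
  set P := cell a ℓ 0 a
  set Q := closedCell a ℓ 0 a
  set W : (Fin n → ℝ) → ℝ≥0∞ := fun y => ENNReal.ofReal (w y)
  -- The stopping construction runs in every cell of level `0`; only its part inside `P` is kept.
  set U : ℕ → Set (Fin n → ℝ) := fun i => stopFamily a ℓ f i ∩ P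
  have hPs : ∀ k, Saturated a ℓ k P := fun k => saturated_cell k.zero_le a
  have hUs : ∀ k, Saturated a ℓ k (U k) := fun k x hx =>
    Set.subset_inter (saturated_stopFamily k x hx.1) (hPs k x hx.2)
  have hU : IsSparse a ℓ U := (isSparse_stopFamily hℓ hf).mono hUs fun k => Set.inter_subset_left
  have hUP : ∀ k, U k ⊆ P := fun k => Set.inter_subset_right
  have hQ : IsCube Q := isCube_closedCell hℓ 0 a
  have hPQ : P ⊆ Q := cell_subset_closedCell hℓ 0 a
  have hQt := hw.weightMeasure_ne_top hQ
  have hcarl : ∑' k, ∫⁻ y in U k, cellAverage a ℓ k W y ≤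
      2 * (aInftyConst w * weightMeasure w Q) := by
    refine (hU.tsum_cellAverage_le hℓ hUP (Φ := hlMaximal (Q.indicator w)) fun k x hx =>
      cellAverage_le_hlMaximal hℓ hw ((hPs k x (hUP k hx)).trans hPQ)).trans ?_
    gcongr
    exact (lintegral_mono_set hPQ).trans (lintegral_hlMaximal_le hQ hQ0 hw)
  -- The member `P` of level `0` alone contributes `w(Q) ≠ 0` to the packing sum.
  have hAQ : aInftyConst w * weightMeasure w Q ≠ 0 := by
    intro hz
    rw [hz, mul_zero, le_zero_iff] at hcarl
    have h1 := ENNReal.tsum_eq_zero.1 hcarl 0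
    have hU0 : U 0 = P := by
      refine Set.inter_eq_right.2 fun x _ => ?_
      simp [stopFamily, stopLevel]
    rw [hU0, setLIntegral_cell_cellAverage, cellAverage_mul_volume hℓ,
      Measure.restrict_congr_set (cell_ae_eq hℓ 0 a), ← weightMeasure_apply hQ.measurableSet] at h1
    exact hQ0 h1
  have hht : ∀ k x, cellAverage a ℓ k h x ≠ ∞ := by
    intro k x
    rw [cellAverage, setLAverage_eq]
    refine (ENNReal.div_lt_top (ne_top_of_le_ne_top ?_ (lintegral_mono hhB))
      (volume_cell_ne_zero hℓ k x)).ne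
    rw [setLIntegral_const]
    exact ENNReal.mul_ne_top hB (volume_cell_ne_top hℓ k x)
  have hbil := hU.bilinear_le hℓ hUP hpq hw.aemeasurable_ofReal hh
    (fun _ => ENNReal.ofReal_ne_top)
    (fun x hx => h0 x ((ENNReal.ofReal_eq_zero.1 hx).antisymm (hw.nonneg x))) hht
    (fun k x => cellAverage_mul_rpow_le_apConst hℓ k x) (apConst_ne_zero hp hw hQ hQ0) hK hcarl
    (mul_ne_zero two_ne_zero hAQ)
    (ENNReal.mul_ne_top ENNReal.ofNat_ne_top (ENNReal.mul_ne_top hA hQt)) hX0 hXt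
  set X := ∫⁻ y in P, h y ^ p * W y
  have hdom : ∫⁻ x in P, ‖f x - cellMean a ℓ 0 f a‖ₑ * h x ≤
      4 * 2 ^ n * bmoNorm w f * ∑' k, ∫⁻ y in U k, cellAverage a ℓ k W y * h y := by
    have hPm : MeasurableSet P := measurableSet_cell 0 a
    have e : ∀ k, ∫⁻ y in U k, cellAverage a ℓ k W y * h y =
        ∫⁻ y in P, (stopFamily a ℓ f k).indicator (cellAverage a ℓ k W) y * h y := by
      intro k
      have hm : MeasurableSet (stopFamily a ℓ f k) := (saturated_stopFamily k).measurableSet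
      rw [← setLIntegral_indicator hm]
      refine lintegral_congr fun y => ?_
      by_cases hy : y ∈ stopFamily a ℓ f k
      · rw [Set.indicator_of_mem hy, Set.indicator_of_mem hy]
      · rw [Set.indicator_of_notMem hy, Set.indicator_of_notMem hy, zero_mul]
    have hc : 4 * 2 ^ n * bmoNorm w f ≠ ∞ := ENNReal.mul_ne_top
      (ENNReal.mul_ne_top ENNReal.ofNat_ne_top (ENNReal.pow_ne_top ENNReal.ofNat_ne_top)) hβ
    simp_rw [e]
    have hme : ∀ k, AEMeasurable (fun y =>
        (stopFamily a ℓ f k).indicator (cellAverage a ℓ k W) y * h y) (volume.restrict P) := fun k =>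
      ((((measurable_cellAverage k W).indicator
        (saturated_stopFamily k).measurableSet).aemeasurable).mul hh).restrict
    rw [← lintegral_tsum hme,
      ← lintegral_const_mul' _ _ hc]
    refine lintegral_mono_ae ?_
    filter_upwards [ae_restrict_mem hPm,
      ae_restrict_of_ae (ae_enorm_sub_le_tsum_weight (a := a) hℓ hf hβ hw)] with x hxP hx
    rw [ENNReal.tsum_mul_right, ← mul_assoc]
    rw [cellMean_eq_of_mem hxP] at hx
    gcongr
  -- The `2` of the packing bound appears to the power `1 / q`; hence the constant `80 = 4 * 10 *
  -- 2`.
  have h2 : (2 : ℝ≥0∞) ^ (1 / q) ≤ 2 := by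
    conv_rhs => rw [← ENNReal.rpow_one 2]
    refine ENNReal.rpow_le_rpow_of_exponent_le (by norm_num) ?_
    rw [div_le_one hpq.symm.pos]
    exact hpq.symm.lt.le
  have hqi := hpq.symm.one_div_nonneg
  calc _ ≤ _ := hdom
    _ ≤ 4 * 2 ^ n * bmoNorm w f * (10 * ENNReal.ofReal q * ((apConst p w * X) ^ (1 / p) *
        (2 * (aInftyConst w * weightMeasure w Q)) ^ (1 / q))) := by gcongr
    _ = 40 * 2 ^ n * bmoNorm w f * ENNReal.ofReal q * (apConst p w ^ (1 / p) * X ^ (1 / p) *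
        (2 ^ (1 / q) * (aInftyConst w ^ (1 / q) * weightMeasure w Q ^ (1 / q)))) := by
      rw [ENNReal.mul_rpow_of_nonneg _ _ hpq.one_div_nonneg, ENNReal.mul_rpow_of_nonneg _ _ hqi,
        ENNReal.mul_rpow_of_nonneg _ _ hqi]
      ring
    _ ≤ 40 * 2 ^ n * bmoNorm w f * ENNReal.ofReal q * (apConst p w ^ (1 / p) * X ^ (1 / p) *
        (2 * (aInftyConst w ^ (1 / q) * weightMeasure w Q ^ (1 / q)))) := by gcongr
    _ = _ := by ring

/-- The weighted estimate for truncations. -/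
theorem setLIntegral_min_rpow_le {p : ℝ} (hp : 1 < p) (hf : LocallyIntegrable f volume)
    (hβ : bmoNorm w f ≠ ∞) (hw : IsWeight w) (hK : apConst p w ≠ ∞) (hA : aInftyConst w ≠ ∞)
    (hQ0 : weightMeasure w (closedCell a ℓ 0 a) ≠ 0) (N : ℕ) :
    ∫⁻ x in cell a ℓ 0 a, min ‖(f x - cellMean a ℓ 0 f a) / w x‖ₑ N ^ p.conjExponent *
        ENNReal.ofReal (w x) ≤
      (80 * 2 ^ n * ENNReal.ofReal p.conjExponent * apConst p w ^ (1 / p) *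
        aInftyConst w ^ (1 / p.conjExponent) * bmoNorm w f) ^ p.conjExponent *
        weightMeasure w (closedCell a ℓ 0 a) := by
  have hpq := Real.HolderConjugate.conjExponent hp
  set q := p.conjExponent
  set m := cellMean a ℓ 0 f a
  set g : (Fin n → ℝ) → ℝ≥0∞ := fun x => min ‖(f x - m) / w x‖ₑ N with hg
  have hq := hpq.symm.pos
  have hq1 : 0 < q - 1 := hpq.symm.sub_one_pos
  have hgm : AEMeasurable g volume :=
    (((hf.aestronglyMeasurable.aemeasurable.sub_const m).div
      hw.locallyIntegrable.aestronglyMeasurable.aemeasurable).enorm).min aemeasurable_const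
  have hgN : ∀ x, g x ≤ N := fun x => min_le_right _ _
  have hNt : (N : ℝ≥0∞) ≠ ∞ := ENNReal.natCast_ne_top N
  have hQ : IsCube (closedCell a ℓ 0 a) := isCube_closedCell hℓ 0 a
  have hQt := hw.weightMeasure_ne_top hQ
  have ehp : ∀ x, (g x ^ (q - 1)) ^ p = g x ^ q := by
    intro x
    rw [← ENNReal.rpow_mul]
    congr 1
    have := hpq.mul_eq_add
    linarith
  set X := ∫⁻ x in cell a ℓ 0 a, g x ^ q * ENNReal.ofReal (w x) with hX
  -- Finiteness is the purpose of the truncation: `X ^ (1 / p)` is cancelled at the end.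
  have hXt : X ≠ ∞ := by
    refine ne_top_of_le_ne_top ?_ (lintegral_mono (g := fun x => (N : ℝ≥0∞) ^ q *
      ENNReal.ofReal (w x)) fun x =>
      mul_le_mul' (ENNReal.rpow_le_rpow (hgN x) hq.le) le_rfl)
    rw [lintegral_const_mul' _ _ (ENNReal.rpow_ne_top_of_nonneg hq.le hNt),
      Measure.restrict_congr_set (cell_ae_eq hℓ 0 a), ← weightMeasure_apply hQ.measurableSet]
    exact ENNReal.mul_ne_top (ENNReal.rpow_ne_top_of_nonneg hq.le hNt) hQt
  by_cases hX0 : X = 0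
  · rw [hX0]; exact zero_le
  -- The extremal test function: `(q - 1) * p = q`, so its norm in `L^p(w)` is `X ^ (1 / p)`. It
  -- vanishes where `w` does because division by zero gives zero.
  have key := setLIntegral_enorm_sub_mul_le (a := a) hℓ hp hf hβ hw hK hA hQ0
    (h := fun x => g x ^ (q - 1)) (hgm.pow_const _)
    (fun x hx => by simp [hg, hx, hq1]) (ENNReal.rpow_ne_top_of_nonneg hq1.le hNt)
    (fun x => ENNReal.rpow_le_rpow (hgN x) hq1.le)
    (by simp only [ehp]; exact hX0) (by simp only [ehp]; exact hXt)
  simp only [ehp] at key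
  have hlow : X ≤ ∫⁻ x in cell a ℓ 0 a, ‖f x - m‖ₑ * g x ^ (q - 1) := by
    refine lintegral_mono fun x => ?_
    by_cases hgx : g x = 0
    · simp [hgx, hq]
    have e1 : g x ^ q = g x * g x ^ (q - 1) := by
      conv_rhs => rw [← ENNReal.rpow_one (g x), ← ENNReal.rpow_mul, one_mul]
      rw [← ENNReal.rpow_add _ _ hgx (ne_top_of_le_ne_top hNt (hgN x))]; congr 1; ring
    have e2 : g x * ENNReal.ofReal (w x) ≤ ‖f x - m‖ₑ := by
      calc g x * ENNReal.ofReal (w x) ≤ ‖(f x - m) / w x‖ₑ * ‖w x‖ₑ := by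
            rw [Real.enorm_of_nonneg (hw.nonneg x)]; gcongr; exact min_le_left _ _
        _ = ‖(f x - m) / w x * w x‖ₑ := (enorm_mul _ _).symm
        _ ≤ ‖f x - m‖ₑ := by
            by_cases hx : w x = 0
            · simp [hx]
            · rw [div_mul_cancel₀ _ hx]
    calc g x ^ q * ENNReal.ofReal (w x) = (g x * ENNReal.ofReal (w x)) * g x ^ (q - 1) := by
          rw [e1]; ring
      _ ≤ _ := by gcongr
  have h1 := hlow.trans key
  have hXp0 : X ^ (1 / p) ≠ 0 := (ENNReal.rpow_pos (pos_iff_ne_zero.2 hX0) hXt).ne'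
  have hXpt : X ^ (1 / p) ≠ ∞ := ENNReal.rpow_ne_top_of_nonneg hpq.one_div_nonneg hXt
  have e3 : X = X ^ (1 / q) * X ^ (1 / p) := by
    rw [← ENNReal.rpow_add _ _ hX0 hXt, one_div, one_div, add_comm, hpq.inv_add_inv_eq_one,
      ENNReal.rpow_one]
  have h2 : X ^ (1 / q) ≤ (80 * 2 ^ n * ENNReal.ofReal q * apConst p w ^ (1 / p) *
      aInftyConst w ^ (1 / q) * bmoNorm w f) * weightMeasure w (closedCell a ℓ 0 a) ^ (1 / q) := by
    refine (ENNReal.mul_le_mul_iff_left hXp0 hXpt).1 ?_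
    rw [← e3]
    exact h1.trans_eq (by ring)
  have h3 := ENNReal.rpow_le_rpow h2 hq.le
  rwa [← ENNReal.rpow_mul, one_div_mul_cancel hq.ne', ENNReal.rpow_one,
    ENNReal.mul_rpow_of_nonneg _ _ hq.le, ← ENNReal.rpow_mul, one_div_mul_cancel hq.ne',
    ENNReal.rpow_one] at h3

/-- Monotone convergence: the bound for the truncations does not depend on `N`. -/
theorem setLIntegral_enorm_div_rpow_le {p : ℝ} (hp : 1 < p) (hf : LocallyIntegrable f volume)
    (hβ : bmoNorm w f ≠ ∞) (hw : IsWeight w) (hK : apConst p w ≠ ∞) (hA : aInftyConst w ≠ ∞)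
    (hQ0 : weightMeasure w (closedCell a ℓ 0 a) ≠ 0) :
    ∫⁻ x in cell a ℓ 0 a, ‖(f x - cellMean a ℓ 0 f a) / w x‖ₑ ^ p.conjExponent *
        ENNReal.ofReal (w x) ≤
      (80 * 2 ^ n * ENNReal.ofReal p.conjExponent * apConst p w ^ (1 / p) *
        aInftyConst w ^ (1 / p.conjExponent) * bmoNorm w f) ^ p.conjExponent *
        weightMeasure w (closedCell a ℓ 0 a) := by
  have hq := (Real.HolderConjugate.conjExponent hp).symm.pos
  set q := p.conjExponent
  set m := cellMean a ℓ 0 f a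
  have hgm : AEMeasurable (fun x => ‖(f x - m) / w x‖ₑ) volume :=
    ((hf.aestronglyMeasurable.aemeasurable.sub_const m).div
      hw.locallyIntegrable.aestronglyMeasurable.aemeasurable).enorm
  have hlim := lintegral_tendsto_of_tendsto_of_monotone (μ := volume.restrict (cell a ℓ 0 a))
    (f := fun (N : ℕ) x => min ‖(f x - m) / w x‖ₑ N ^ q * ENNReal.ofReal (w x))
    (F := fun x => ‖(f x - m) / w x‖ₑ ^ q * ENNReal.ofReal (w x))
    (fun N => (((hgm.min aemeasurable_const).pow_const _).mul hw.aemeasurable_ofReal).restrict)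
    (Filter.Eventually.of_forall fun x N N' hN => by
      dsimp only
      gcongr)
    (Filter.Eventually.of_forall fun x => by
      obtain ⟨M, hM⟩ := ENNReal.exists_nat_gt (r := ‖(f x - m) / w x‖ₑ) enorm_ne_top
      refine tendsto_const_nhds.congr' ?_
      filter_upwards [Filter.eventually_ge_atTop M] with N hN
      rw [min_eq_left (hM.le.trans (by exact_mod_cast hN))])
  exact le_of_tendsto' hlim fun N => setLIntegral_min_rpow_le hℓ hp hf hβ hw hK hA hQ0 N

end WeightedEstimate

/-! ### Norm estimates for the normalized weight measure -/

noncomputable section NormEstimates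

variable {n : ℕ} {w f : (Fin n → ℝ) → ℝ}

/-- Here the normalizing factor is `∞`, but `∞ • 0 = 0`, in accordance with the convention for cubes
of zero mass. -/
theorem normalizedWeightMeasure_eq_zero {Q : Set (Fin n → ℝ)} (h : weightMeasure w Q = 0) :
    normalizedWeightMeasure w Q = 0 := by
  rw [normalizedWeightMeasure, Measure.restrict_eq_zero.2 h, smul_zero]

theorem normalizedWeightMeasure_absolutelyContinuous (w : (Fin n → ℝ) → ℝ)
    (Q : Set (Fin n → ℝ)) : normalizedWeightMeasure w Q ≪ volume :=
  Measure.smul_absolutelyContinuous.trans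
    (Measure.restrict_le_self.absolutelyContinuous.trans (withDensity_absolutelyContinuous _ _))

theorem lintegral_normalizedWeightMeasure (hw : IsWeight w) {Q : Set (Fin n → ℝ)} (hQ : IsCube Q)
    {g : (Fin n → ℝ) → ℝ≥0∞} (hg : AEMeasurable g volume) :
    ∫⁻ x, g x ∂normalizedWeightMeasure w Q =
      (weightMeasure w Q)⁻¹ * ∫⁻ x in Q, g x * ENNReal.ofReal (w x) := by
  rw [normalizedWeightMeasure, lintegral_smul_measure, smul_eq_mul, weightMeasure,
    restrict_withDensity hQ.measurableSet,
    lintegral_withDensity_eq_lintegral_mul₀ hw.aemeasurable_ofReal.restrict hg.restrict]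
  simp only [Pi.mul_apply, mul_comm]

theorem aemeasurable_sub_div (hf : LocallyIntegrable f volume) (hw : IsWeight w) (m : ℝ) :
    AEMeasurable (fun x => (f x - m) / w x) volume :=
  (hf.aestronglyMeasurable.aemeasurable.sub_const m).div
    hw.locallyIntegrable.aestronglyMeasurable.aemeasurable

theorem eLpNorm_normalizedWeightMeasure (hw : IsWeight w) {Q : Set (Fin n → ℝ)} (hQ : IsCube Q)
    {g : (Fin n → ℝ) → ℝ} (hg : AEMeasurable g volume) {q : ℝ} (hq : 0 < q) :
    eLpNorm g (ENNReal.ofReal q) (normalizedWeightMeasure w Q) =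
      ((weightMeasure w Q)⁻¹ * ∫⁻ x in Q, ‖g x‖ₑ ^ q * ENNReal.ofReal (w x)) ^ (1 / q) := by
  rw [eLpNorm_eq_lintegral_rpow_enorm_toReal (by simpa using hq) ENNReal.ofReal_ne_top,
    ENNReal.toReal_ofReal hq.le, lintegral_normalizedWeightMeasure hw hQ (hg.enorm.pow_const _)]

/-- The estimate in the dual exponent for `A_p` weights. -/
theorem eLpNorm_sub_div_le_of_apConst {p : ℝ} (hp : 1 < p) (hf : LocallyIntegrable f volume)
    (hβ : bmoNorm w f ≠ ∞) (hw : IsWeight w) (hK : apConst p w ≠ ∞) {Q : Set (Fin n → ℝ)}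
    (hQ : IsCube Q) :
    eLpNorm (fun x => (f x - ⨍ y in Q, f y) / w x) (ENNReal.ofReal p.conjExponent)
        (normalizedWeightMeasure w Q) ≤
      ENNReal.ofReal (80 * 2 ^ n * p.conjExponent) * apConst p w ^ (1 / p) *
        aInftyConst w ^ (1 / p.conjExponent) * bmoNorm w f := by
  have hpq := Real.HolderConjugate.conjExponent hp
  have hq := hpq.symm.pos
  by_cases hQ0 : weightMeasure w Q = 0
  · rw [normalizedWeightMeasure_eq_zero hQ0, eLpNorm_measure_zero]; exact zero_le
  have hg := aemeasurable_sub_div hf hw (⨍ y in Q, f y)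
  have hQt := hw.weightMeasure_ne_top hQ
  -- Finiteness of `aInftyConst w` is not deduced from the `A_p` condition. If it fails, the right
  -- side is `∞` unless `bmoNorm w f = 0`; in that case it is `0`, and `f` is almost everywhere
  -- constant on `Q`.
  by_cases hA : aInftyConst w = ∞
  · by_cases hβ0 : bmoNorm w f = 0
    · have h1 := lintegral_enorm_sub_le_bmoNorm hβ hw hQ
      rw [hβ0, zero_mul, le_zero_iff, lintegral_eq_zero_iff'
        (hf.aestronglyMeasurable.aemeasurable.sub_const _).enorm.restrict] at h1
      have h2 : ∫⁻ x in Q, ‖(f x - ⨍ y in Q, f y) / w x‖ₑ ^ p.conjExponent *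
          ENNReal.ofReal (w x) = 0 := by
        rw [← lintegral_zero (μ := volume.restrict Q)]
        refine lintegral_congr_ae ?_
        filter_upwards [h1] with x hx
        have hx' : f x - ⨍ y in Q, f y = 0 := enorm_eq_zero.1 hx
        simp [hx', hq]
      rw [eLpNorm_normalizedWeightMeasure hw hQ hg hq, h2, mul_zero,
        ENNReal.zero_rpow_of_pos hpq.symm.one_div_pos]
      exact zero_le
    · have hK0 := apConst_ne_zero hp hw hQ hQ0
      have hKp : apConst p w ^ (1 / p) ≠ 0 :=
        (ENNReal.rpow_pos (pos_iff_ne_zero.2 hK0) hK).ne'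
      have hc : ENNReal.ofReal (80 * 2 ^ n * p.conjExponent) ≠ 0 := by
        rw [ENNReal.ofReal_ne_zero_iff]; positivity
      rw [hA, ENNReal.top_rpow_of_pos hpq.symm.one_div_pos,
        ENNReal.mul_top (mul_ne_zero hc hKp), ENNReal.top_mul hβ0]
      exact le_top
  · rw [eLpNorm_normalizedWeightMeasure hw hQ hg hq]
    obtain ⟨a, ℓ, hℓ, rfl⟩ := hQ
    rw [← closedCell_zero_base] at hQ0 hQt ⊢
    have key := setLIntegral_enorm_div_rpow_le (a := a) hℓ hp hf hβ hw hK hA hQ0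
    rw [Measure.restrict_congr_set (cell_ae_eq hℓ 0 a), cellMean_eq_closedCell hℓ] at key
    have hc : ENNReal.ofReal (80 * 2 ^ n * p.conjExponent) =
        80 * 2 ^ n * ENNReal.ofReal p.conjExponent := by
      rw [ENNReal.ofReal_mul (by positivity), ENNReal.ofReal_mul (by norm_num),
        ENNReal.ofReal_pow (by norm_num), ENNReal.ofReal_ofNat, ENNReal.ofReal_ofNat]
    rw [hc]
    set M := 80 * 2 ^ n * ENNReal.ofReal p.conjExponent * apConst p w ^ (1 / p) *
        aInftyConst w ^ (1 / p.conjExponent) * bmoNorm w f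
    calc _ ≤ ((weightMeasure w (closedCell a ℓ 0 a))⁻¹ *
          (M ^ p.conjExponent * weightMeasure w (closedCell a ℓ 0 a))) ^ (1 / p.conjExponent) := by
          gcongr
      _ = M := by
          rw [mul_comm, mul_assoc, ENNReal.mul_inv_cancel hQ0 hQt, mul_one, ← ENNReal.rpow_mul,
            mul_one_div_cancel hq.ne', ENNReal.rpow_one]

theorem ae_hlMaximal_le (hA : a1Const w ≠ ∞) :
    ∀ᵐ x, hlMaximal w x ≤ a1Const w * ENNReal.ofReal (w x) := by
  filter_upwards [ENNReal.ae_le_essSup fun x => hlMaximal w x / ENNReal.ofReal (w x)] with x hx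
  exact (ENNReal.div_le_iff_le_mul (Or.inr hA) (Or.inl ENNReal.ofReal_ne_top)).1 hx

theorem hlMaximal_indicator_le (Q : Set (Fin n → ℝ)) (x : Fin n → ℝ) :
    hlMaximal (Q.indicator w) x ≤ hlMaximal w x := by
  refine iSup_mono fun R => iSup_mono fun _ => iSup_mono fun _ => ?_
  rw [setLAverage_eq, setLAverage_eq]
  gcongr with y
  exact enorm_indicator_le_enorm_self _ _

theorem aInftyConst_le_a1Const (hA : a1Const w ≠ ∞) : aInftyConst w ≤ a1Const w := by
  refine iSup₂_le fun Q hQ => ENNReal.div_le_of_le_mul ?_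
  rw [weightMeasure_apply hQ.measurableSet, ← lintegral_const_mul' _ _ hA]
  refine lintegral_mono_ae (ae_restrict_of_ae ?_)
  filter_upwards [ae_hlMaximal_le hA] with x hx
  exact (hlMaximal_indicator_le Q x).trans hx

/-- Almost everywhere on `Q`, `w` is at least its mean `v` divided by `[w]_{A_1}`. The exponent `1 -
p'` is negative and `(1 - p') * (p - 1) = -1`, so the second factor is at most `[w]_{A_1} / v`. -/
theorem apConst_le_a1Const {p : ℝ} (hp : 1 < p) (hw : IsWeight w) (hA : a1Const w ≠ ∞) :
    apConst p w ≤ a1Const w := by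
  have hpq := Real.HolderConjugate.conjExponent hp
  refine iSup₂_le fun Q hQ => ?_
  have hv : volume Q ≠ 0 := by
    obtain ⟨a, ℓ, hℓ, rfl⟩ := hQ
    rw [Real.volume_Icc_pi]
    simp [hℓ]
  have hvt : volume Q ≠ ∞ := by
    obtain ⟨a, ℓ, _, rfl⟩ := hQ
    exact isCompact_Icc.measure_lt_top.ne
  set v := ⨍⁻ x in Q, ENNReal.ofReal (w x) ∂volume with hvdef
  have hvf : v ≠ ∞ := by
    rw [hvdef, setLAverage_eq, ← weightMeasure_apply hQ.measurableSet]
    exact (ENNReal.div_lt_top (hw.weightMeasure_ne_top hQ) hv).ne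
  by_cases hv0 : v = 0
  · rw [hv0, zero_mul]; exact zero_le
  have hle : ∀ᵐ x ∂volume.restrict Q, v ≤ a1Const w * ENNReal.ofReal (w x) := by
    filter_upwards [ae_restrict_of_ae (ae_hlMaximal_le hA), ae_restrict_mem hQ.measurableSet]
      with x hx hxQ
    refine le_trans ?_ hx
    have : v = ⨍⁻ y in Q, ‖w y‖ₑ ∂volume := by
      simp only [hvdef, Real.enorm_of_nonneg (hw.nonneg _)]
    rw [this]
    exact le_iSup_of_le Q (le_iSup_of_le hQ (le_iSup_of_le hxQ le_rfl))
  have hA0 : a1Const w ≠ 0 := by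
    intro h0
    have : ∀ᵐ _ ∂volume.restrict Q, False := by
      filter_upwards [hle] with x hx
      rw [h0, zero_mul] at hx
      exact hv0 (le_zero_iff.1 hx)
    rw [Filter.eventually_false_iff_eq_bot, ae_eq_bot, Measure.restrict_eq_zero] at this
    exact hv this
  have hq1 : 0 ≤ p.conjExponent - 1 := hpq.symm.sub_one_pos.le
  have hσ : ⨍⁻ x in Q, ENNReal.ofReal (w x) ^ (1 - p.conjExponent) ∂volume ≤
      (v / a1Const w) ^ (1 - p.conjExponent) := by
    rw [setLAverage_eq]
    refine ENNReal.div_le_of_le_mul ?_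
    rw [← setLIntegral_const]
    refine lintegral_mono_ae ?_
    filter_upwards [hle] with x hx
    rw [← neg_sub, ENNReal.rpow_neg, ENNReal.rpow_neg]
    gcongr
    rw [ENNReal.div_le_iff_le_mul (Or.inl hA0) (Or.inl hA), mul_comm]
    exact hx
  calc v * (⨍⁻ x in Q, ENNReal.ofReal (w x) ^ (1 - p.conjExponent) ∂volume) ^ (p - 1)
      ≤ v * ((v / a1Const w) ^ (1 - p.conjExponent)) ^ (p - 1) := by
        gcongr
    _ = v * (a1Const w / v) := by
        rw [← ENNReal.rpow_mul]
        have : (1 - p.conjExponent) * (p - 1) = -1 := by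
          have := hpq.mul_eq_add
          linarith
        rw [this, ENNReal.rpow_neg_one, ENNReal.inv_div (Or.inl hA) (Or.inl hA0)]
    _ = a1Const w := ENNReal.mul_div_cancel hv0 hvf

/-- The power series of the exponential, in `[0, ∞]`. -/
theorem ENNReal.ofReal_exp_sub_one {t : ℝ} (ht : 0 ≤ t) :
    ENNReal.ofReal (Real.exp t - 1) =
      ∑' k : ℕ, ENNReal.ofReal (t ^ (k + 1) / (k + 1).factorial) := by
  have h := NormedSpace.expSeries_div_hasSum_exp (𝔸 := ℝ) t
  rw [← Real.exp_eq_exp_ℝ] at h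
  have h1 := (hasSum_nat_add_iff' 1).2 h
  simp only [Finset.range_one, Finset.sum_singleton, pow_zero, Nat.factorial_zero, Nat.cast_one,
    div_one] at h1
  rw [← h1.tsum_eq, ENNReal.ofReal_tsum_of_nonneg (fun k => by positivity) h1.summable]

/-- Linear growth of the `L^k` norms gives exponential integrability. -/
theorem expLNorm_le_of_lintegral_pow_le {α : Type*} [MeasurableSpace α] {μ : Measure α} {g : α → ℝ}
    (hg : AEMeasurable g μ) {L : ℝ} (hL : 0 ≤ L)
    (h : ∀ k : ℕ, 1 ≤ k → ∫⁻ x, ‖g x‖ₑ ^ k ∂μ ≤ ENNReal.ofReal (k * L) ^ k) :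
    expLNorm g μ ≤ ENNReal.ofReal (6 * L) := by
  -- Working with `s > 6 * L` rather than `s = 6 * L` keeps `s` positive when `L = 0`.
  refine le_of_forall_gt_imp_ge_of_dense fun r hr => ?_
  rcases eq_or_ne r ∞ with rfl | hrt
  · exact le_top
  have hs : 6 * L < r.toReal := (ENNReal.ofReal_lt_iff_lt_toReal (by positivity) hrt).1 hr
  set s := r.toReal with hsdef
  have hs0 : 0 < s := lt_of_le_of_lt (by positivity) hs
  rw [← ENNReal.ofReal_toReal hrt, ← hsdef]
  refine iInf_le_of_le s (iInf_le_of_le hs0 (iInf_le_of_le ?_ le_rfl))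
  have hterm : ∀ (k : ℕ) (x : α), ENNReal.ofReal ((|g x| / s) ^ k / k.factorial) =
      ENNReal.ofReal ((s ^ k * k.factorial)⁻¹) * ‖g x‖ₑ ^ k := by
    intro k x
    rw [Real.enorm_eq_ofReal_abs, ← ENNReal.ofReal_pow (abs_nonneg _),
      ← ENNReal.ofReal_mul (by positivity)]
    congr 1
    rw [div_pow]; field_simp
  -- With `m = k + 1`, `m ^ m / m! ≤ exp m ≤ 3 ^ m` and `L / s ≤ 1 / 6`, so the term is at most `(1
  -- / 2) ^ m`; these sum to exactly `1`.
  have hbound : ∀ k : ℕ, ∫⁻ x, ENNReal.ofReal ((|g x| / s) ^ (k + 1) / (k + 1).factorial) ∂μ ≤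
      (1 / 2 : ℝ≥0∞) ^ (k + 1) := by
    intro k
    simp_rw [hterm]
    rw [lintegral_const_mul' _ _ ENNReal.ofReal_ne_top]
    have hhalf : (1 / 2 : ℝ≥0∞) ^ (k + 1) = ENNReal.ofReal ((1 / 2 : ℝ) ^ (k + 1)) := by
      rw [ENNReal.ofReal_pow (by norm_num), ENNReal.ofReal_div_of_pos (by norm_num)]
      simp
    calc _ ≤ ENNReal.ofReal ((s ^ (k + 1) * (k + 1).factorial)⁻¹) *
          ENNReal.ofReal ((k + 1 : ℕ) * L) ^ (k + 1) := by
          gcongr; exact h (k + 1) (by omega)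
      _ ≤ _ := by
        rw [hhalf, ← ENNReal.ofReal_pow (by positivity), ← ENNReal.ofReal_mul (by positivity)]
        refine ENNReal.ofReal_le_ofReal ?_
        have h1 := Real.pow_div_factorial_le_exp ((k + 1 : ℕ) : ℝ) (by positivity) (k + 1)
        have h2 : Real.exp ((k + 1 : ℕ) : ℝ) ≤ 3 ^ (k + 1) := by
          rw [← mul_one ((k + 1 : ℕ) : ℝ), Real.exp_nat_mul]
          gcongr
          linarith [Real.exp_one_lt_d9]
        calc (s ^ (k + 1) * ((k + 1).factorial : ℝ))⁻¹ * (((k + 1 : ℕ) : ℝ) * L) ^ (k + 1)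
            = (((k + 1 : ℕ) : ℝ) ^ (k + 1) / (k + 1).factorial) * (L / s) ^ (k + 1) := by
              rw [mul_pow, div_pow]; field_simp
          _ ≤ 3 ^ (k + 1) * (1 / 6) ^ (k + 1) := by
              have h3 : L / s ≤ 1 / 6 := by rw [div_le_iff₀ hs0]; linarith
              gcongr
              exact h1.trans h2
          _ = _ := by rw [← mul_pow]; norm_num
  have hpt : ∀ x, ENNReal.ofReal (Real.exp (|g x| / s) - 1) =
      ∑' k : ℕ, ENNReal.ofReal ((|g x| / s) ^ (k + 1) / (k + 1).factorial) := fun x =>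
    ENNReal.ofReal_exp_sub_one (by positivity)
  simp_rw [hpt]
  rw [lintegral_tsum fun k => (by fun_prop)]
  refine (ENNReal.tsum_le_tsum hbound).trans ?_
  simp_rw [pow_succ]
  rw [ENNReal.tsum_mul_right, ENNReal.tsum_geometric]
  simp only [one_div, ENNReal.one_sub_inv_two, inv_inv]
  rw [ENNReal.mul_inv_cancel two_ne_zero ENNReal.ofNat_ne_top]

/-- The estimate in every exponent for `A_1` weights. -/
theorem eLpNorm_sub_div_le_of_a1Const {q : ℝ} (hq : 1 < q) (hf : LocallyIntegrable f volume)
    (hβ : bmoNorm w f ≠ ∞) (hw : IsWeight w) (hA : a1Const w ≠ ∞) {Q : Set (Fin n → ℝ)}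
    (hQ : IsCube Q) :
    eLpNorm (fun x => (f x - ⨍ y in Q, f y) / w x) (ENNReal.ofReal q)
        (normalizedWeightMeasure w Q) ≤
      ENNReal.ofReal (80 * 2 ^ n * q) * a1Const w ^ (1 / q.conjExponent) *
        aInftyConst w ^ (1 / q) * bmoNorm w f := by
  -- The dual-exponent estimate is used with `p = q'`, whose conjugate exponent is `q`.
  have hpq := Real.HolderConjugate.conjExponent hq
  have hp : 1 < q.conjExponent := hpq.symm.lt
  have hK := apConst_le_a1Const hp hw hA
  have h := eLpNorm_sub_div_le_of_apConst hp hf hβ hw (ne_top_of_le_ne_top hA hK) hQ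
  have e : q.conjExponent.conjExponent = q := hpq.symm.conjugate_eq.symm
  rw [e] at h
  refine h.trans ?_
  gcongr

/-- Bounding `[w]_{A_∞}` by `[w]_{A_1}` merges the two powers into one. The exponent `k = 1` is
outside the range `q > 1`; on a probability measure it follows from `q = 2`, which doubles `80` to
`160`. -/
theorem lintegral_enorm_sub_div_pow_le (hf : LocallyIntegrable f volume)
    (hβ : bmoNorm w f ≠ ∞) (hw : IsWeight w) (hA : a1Const w ≠ ∞) {Q : Set (Fin n → ℝ)}
    (hQ : IsCube Q) {k : ℕ} (hk : 1 ≤ k) :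
    ∫⁻ x, ‖(f x - ⨍ y in Q, f y) / w x‖ₑ ^ k ∂normalizedWeightMeasure w Q ≤
      (ENNReal.ofReal (160 * 2 ^ n * k) * (a1Const w * bmoNorm w f)) ^ k := by
  set g : (Fin n → ℝ) → ℝ := fun x => (f x - ⨍ y in Q, f y) / w x
  set μ := normalizedWeightMeasure w Q with hμ
  by_cases hQ0 : weightMeasure w Q = 0
  · rw [hμ, normalizedWeightMeasure_eq_zero hQ0, lintegral_zero_measure]; exact zero_le
  have hprob : IsProbabilityMeasure μ := by
    refine ⟨?_⟩
    rw [hμ, normalizedWeightMeasure, Measure.smul_apply, Measure.restrict_apply_univ, smul_eq_mul,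
      ENNReal.inv_mul_cancel hQ0 (hw.weightMeasure_ne_top hQ)]
  have hgm : AEStronglyMeasurable g μ :=
    ((aemeasurable_sub_div hf hw _).mono_ac
      (normalizedWeightMeasure_absolutelyContinuous w Q)).aestronglyMeasurable
  have hbound : ∀ q : ℝ, 1 < q → eLpNorm g (ENNReal.ofReal q) μ ≤
      ENNReal.ofReal (80 * 2 ^ n * q) * (a1Const w * bmoNorm w f) := by
    intro q hq
    have hpq := Real.HolderConjugate.conjExponent hq
    refine (eLpNorm_sub_div_le_of_a1Const hq hf hβ hw hA hQ).trans ?_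
    have e : a1Const w ^ (1 / q.conjExponent) * aInftyConst w ^ (1 / q) ≤ a1Const w := by
      calc _ ≤ a1Const w ^ (1 / q.conjExponent) * a1Const w ^ (1 / q) := by
            gcongr
            exact aInftyConst_le_a1Const hA
        _ = a1Const w := by
            rw [← ENNReal.rpow_add_of_nonneg _ _ hpq.symm.one_div_nonneg hpq.one_div_nonneg,
              one_div, one_div, add_comm, hpq.inv_add_inv_eq_one, ENNReal.rpow_one]
    rw [mul_assoc (ENNReal.ofReal _), mul_assoc (ENNReal.ofReal _)]
    gcongr
  have hnorm : eLpNorm g k μ ≤ ENNReal.ofReal (160 * 2 ^ n * k) * (a1Const w * bmoNorm w f) := by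
    rcases hk.eq_or_lt with rfl | hk
    · refine (eLpNorm_le_eLpNorm_of_exponent_le (q := ENNReal.ofReal 2) (by simp) hgm).trans
        ((hbound 2 (by norm_num)).trans ?_)
      refine mul_le_mul' (ENNReal.ofReal_le_ofReal ?_) le_rfl
      push_cast; linarith
    · have := hbound k (by exact_mod_cast hk)
      rw [ENNReal.ofReal_natCast] at this
      refine this.trans ?_
      gcongr
      norm_num
  have hk0 : k ≠ 0 := by omega
  have e := eLpNorm_eq_lintegral_rpow_enorm_toReal (f := g) (μ := μ) (p := (k : ℝ≥0∞))
    (by exact_mod_cast hk0) (ENNReal.natCast_ne_top k)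
  simp only [ENNReal.toReal_natCast, ENNReal.rpow_natCast] at e
  have e2 : ∫⁻ x, ‖g x‖ₑ ^ k ∂μ = eLpNorm g k μ ^ k := by
    rw [e, ← ENNReal.rpow_natCast, ← ENNReal.rpow_mul, one_div_mul_cancel (by exact_mod_cast hk0),
      ENNReal.rpow_one]
  rw [e2]
  gcongr

/-- The exponential estimate for `A_1` weights. -/
theorem expLNorm_sub_div_le (hf : LocallyIntegrable f volume)
    (hβ : bmoNorm w f ≠ ∞) (hw : IsWeight w) (hA : a1Const w ≠ ∞) {Q : Set (Fin n → ℝ)}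
    (hQ : IsCube Q) :
    expLNorm (fun x => (f x - ⨍ y in Q, f y) / w x) (normalizedWeightMeasure w Q) ≤
      ENNReal.ofReal (960 * 2 ^ n) * a1Const w * bmoNorm w f := by
  have hM : a1Const w * bmoNorm w f ≠ ∞ := ENNReal.mul_ne_top hA hβ
  have h := expLNorm_le_of_lintegral_pow_le
    ((aemeasurable_sub_div hf hw (⨍ y in Q, f y)).mono_ac
      (normalizedWeightMeasure_absolutelyContinuous w Q))
    (L := 160 * 2 ^ n * (a1Const w * bmoNorm w f).toReal) (by positivity) fun k hk => by
      refine (lintegral_enorm_sub_div_pow_le hf hβ hw hA hQ hk).trans_eq ?_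
      congr 1
      rw [show (k : ℝ) * (160 * 2 ^ n * (a1Const w * bmoNorm w f).toReal) =
        160 * 2 ^ n * k * (a1Const w * bmoNorm w f).toReal by ring,
        ENNReal.ofReal_mul (p := 160 * 2 ^ n * (k : ℝ)) (by positivity), ENNReal.ofReal_toReal hM]
  refine h.trans_eq ?_
  rw [show 6 * (160 * 2 ^ n * (a1Const w * bmoNorm w f).toReal) =
      960 * 2 ^ n * (a1Const w * bmoNorm w f).toReal by ring,
    ENNReal.ofReal_mul (by positivity), ENNReal.ofReal_toReal hM, mul_assoc]

end NormEstimates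

theorem mainTheorem4 (n : ℕ) (hn : 0 < n) :
    ∃ c : ℝ, 0 < c ∧ ∀ w f : (Fin n → ℝ) → ℝ, MemBMO w f →
      (MemA1 w →
        (∀ q : ℝ, 1 < q → ∀ Q : Set (Fin n → ℝ), IsCube Q →
          eLpNorm (fun x => (f x - ⨍ y in Q, f y) / w x) (ENNReal.ofReal q)
              (normalizedWeightMeasure w Q)
            ≤ ENNReal.ofReal (c * q) * a1Const w ^ (1 / q.conjExponent)
              * aInftyConst w ^ (1 / q) * bmoNorm w f) ∧
        (∀ Q : Set (Fin n → ℝ), IsCube Q →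
          expLNorm (fun x => (f x - ⨍ y in Q, f y) / w x) (normalizedWeightMeasure w Q)
            ≤ ENNReal.ofReal c * a1Const w * bmoNorm w f)) ∧
      (∀ p : ℝ, 1 < p → MemAp p w → ∀ Q : Set (Fin n → ℝ), IsCube Q →
          eLpNorm (fun x => (f x - ⨍ y in Q, f y) / w x) (ENNReal.ofReal p.conjExponent)
              (normalizedWeightMeasure w Q)
            ≤ ENNReal.ofReal (c * p.conjExponent) * apConst p w ^ (1 / p)
              * aInftyConst w ^ (1 / p.conjExponent) * bmoNorm w f) := by
  -- `960 = 6 * 160` comes from the exponential estimate and dominates the `80` of the other two.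
  refine ⟨960 * 2 ^ n, by positivity, fun w f ⟨hf, hβ⟩ => ⟨fun ⟨hw, hA⟩ => ⟨?_, ?_⟩, ?_⟩⟩
  · intro q hq Q hQ
    refine (eLpNorm_sub_div_le_of_a1Const hq hf hβ.ne hw hA.ne hQ).trans ?_
    gcongr
    norm_num
  · intro Q hQ
    exact expLNorm_sub_div_le hf hβ.ne hw hA.ne hQ
  · intro p hp ⟨hw, hK⟩ Q hQ
    have hq := (Real.HolderConjugate.conjExponent hp).symm.pos
    refine (eLpNorm_sub_div_le_of_apConst hp hf hβ.ne hw hK.ne hQ).trans ?_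
    gcongr
    norm_num
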